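/- Consider five observables $A_0,A_1,B,C_0,C_1$ (parties $A$ and $C$ have two settings $x,z\in\{0,1\}$ each, party $B$ has one fixed measurement). A set of observables is *jointly measurable* if it contains at most one of $A_0,A_1$ and at most one of $C_0,C_1$; there are 17 nonempty such sets. Let $\Gamma$ be the cone of all functions $H$ from the subsets of $\{A_0,A_1,B,C_0,C_1\}$ to $\mathbb R$ that satisfy $H(\emptyset)=0$, monotonicity and submodularity (the Shannon inequalities), together with $I(A_0A_1:C_0C_1)=0$, i.e. $H(A_0A_1C_0C_1)=H(A_0A_1)+H(C_0C_1)$. Let $K\subseteq\mathbb R^{17}$ be the projection of $\Gamma$ to the entropies of the nonempty jointly measurable sets. Consider the following ten inequalities: 1. $H(A_0B)-H(A_0)-H(B)\le0$ 2. $H(A_0B)-H(A_0BC_0)\le0$ 3. $H(A_0)+H(C_0)-H(A_0BC_0)\le0$ 4. $H(B)-H(A_0B)-H(BC_0)+H(A_0BC_0)\le0$ 5. $H(A_1)+H(C_0)+H(A_0B)-H(A_1B)-H(A_0BC_0)\le0$ 6. $H(A_1)+H(C_1)+H(A_0B)-H(A_1B)+H(BC_0)-H(BC_1)-H(A_0BC_0)\le0$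 7. $H(A_0)+H(C_0)-H(A_0BC_1)-H(A_1BC_0)+H(A_1BC_1)\le0$ 8. $H(A_0)+H(C_0)-H(A_0B)+H(A_1B)-H(A_0BC_0)+H(A_0BC_1)-H(A_1BC_1)\le0$ 9. $H(A_0)+H(C_0)-H(A_0B)+H(A_1B)-H(BC_0)+H(BC_1)+H(A_0BC_0)-H(A_0BC_1)-H(A_1BC_0)\le0$ 10. $H(A_0B)+H(BC_0)-H(A_0BC_0)-H(A_0BC_1)-H(A_1BC_0)+H(A_1BC_1)\le0$ Two inequalities are *equivalent* if one arises from the other by a permutation of the five observables that maps jointly measurable sets to jointly measurable sets. Then: (a) The inequalities equivalent to one of the ten above are exactly 52 in number. They form 10 equivalence classes, each containing exactly one of the ten. (b) $K$ is the set of all points of $\mathbb R^{17}$ that satisfy the four equations $I(A_x:C_z)=H(A_x)+H(C_z)-H(A_xC_z)=0$ $(x,z\in\{0,1\})$ and the 52 inequalities. The linear span of $K$ is the subspace defined by the four equations. The 52 inequalities are tight: sending an inequality to the set of points of $K$ where equality holds is a bijection from the 52 inequalities onto the set of facets (faces of codimension one) of $K$. (c) For every bilocal model with finite outcome alphabets,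 i.e. every $$P(a,b,c|x,z)=\sum_{\lambda_1,\lambda_2}\rho_1(\lambda_1)\rho_2(\lambda_2)P(a|x,\lambda_1)P(b|\lambda_1,\lambda_2)P(c|z,\lambda_2)$$ with discrete $\lambda_1,\lambda_2$ (finitely or infinitely many values), the Shannon entropies (in bits) of the outcomes of the jointly measurable sets are well defined, form a point of $K$, and so satisfy the four equations and the 52 inequalities. (d) The inequalities equivalent to 1–4 hold for every no-signaling box $P(a,b,c|x,z)$ with finite outcome alphabets such that $\sum_bP(a,b,c|x,z)=P(a|x)P(c|z)$ for all $a,c,x,z$. Each of the inequalities equivalent to 5–10 is violated by some non-bilocal no-signaling box (with binary outcomes) that satisfies this condition. -/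

import Mathlib

/-! ### The observables and the marginal scenario -/

/-- The five observables `A₀, A₁, B, C₀, C₁`. -/
inductive Obs : Type
  | A (x : Fin 2)
  | B
  | C (z : Fin 2)
  deriving DecidableEq, Fintype

/-- A set of observables is jointly measurable if it contains at most one observable of `A`
and at most one observable of `C`. -/
def JointlyMeasurable (S : Finset Obs) : Prop :=
  ¬ (Obs.A 0 ∈ S ∧ Obs.A 1 ∈ S) ∧ ¬ (Obs.C 0 ∈ S ∧ Obs.C 1 ∈ S)

instance : DecidablePred JointlyMeasurable := fun S =>
  inferInstanceAs (Decidable (¬ (Obs.A 0 ∈ S ∧ Obs.A 1 ∈ S) ∧ ¬ (Obs.C 0 ∈ S ∧ Obs.C 1 ∈ S)))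

/-- The nonempty jointly measurable sets; there are 17 of them. (The coordinate of the empty
set is left out because `H(∅) = 0` always.) -/
abbrev MSet : Type := {S : Finset Obs // S.Nonempty ∧ JointlyMeasurable S}

/-! ### The Shannon cone with the independence constraint, and its projection -/

/-- `h : Finset Obs → ℝ` satisfies the basic (Shannon) inequalities of joint entropies:
normalization, monotonicity and submodularity. -/
def IsShannon (h : Finset Obs → ℝ) : Prop :=
  h ∅ = 0 ∧ (∀ S T, S ⊆ T → h S ≤ h T) ∧ (∀ S T, h (S ∪ T) + h (S ∩ T) ≤ h S + h T)

/-- `I(S : T) = H(S) + H(T) - H(S ∪ T)`. -/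
def mutualInfo (h : Finset Obs → ℝ) (S T : Finset Obs) : ℝ := h S + h T - h (S ∪ T)

/-- The Shannon cone of the five observables, cut by `I(A₀A₁ : C₀C₁) = 0`. -/
def bilocalShannonCone : Set (Finset Obs → ℝ) :=
  {h | IsShannon h ∧ mutualInfo h {Obs.A 0, Obs.A 1} {Obs.C 0, Obs.C 1} = 0}

/-- The projection of the cone to the joint entropies of jointly measurable observables. -/
def marginalCone : Set (MSet → ℝ) :=
  (fun (h : Finset Obs → ℝ) (S : MSet) => h S.1) '' bilocalShannonCone

theorem A_mem (x : Fin 2) :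
    ({Obs.A x} : Finset Obs).Nonempty ∧ JointlyMeasurable {Obs.A x} := by
  revert x; decide

theorem C_mem (z : Fin 2) :
    ({Obs.C z} : Finset Obs).Nonempty ∧ JointlyMeasurable {Obs.C z} := by
  revert z; decide

theorem AC_mem (x z : Fin 2) :
    ({Obs.A x, Obs.C z} : Finset Obs).Nonempty ∧ JointlyMeasurable {Obs.A x, Obs.C z} := by
  revert x z; decide

/-- `I(A_x : C_z)` in terms of the entropies of the jointly measurable sets. -/
def mutualInfoAC (h : MSet → ℝ) (x z : Fin 2) : ℝ :=
  h ⟨{Obs.A x}, A_mem x⟩ + h ⟨{Obs.C z}, C_mem z⟩ - h ⟨{Obs.A x, Obs.C z}, AC_mem x z⟩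

/-- The exposed faces of codimension one of a convex cone `K`. -/
def IsFacet {V : Type*} [AddCommGroup V] [Module ℝ V] (K F : Set V) : Prop :=
  ∃ l : V →ₗ[ℝ] ℝ, (∀ h ∈ K, l h ≤ 0) ∧ F = {h ∈ K | l h = 0} ∧
    Module.finrank ℝ (Submodule.span ℝ F) + 1 = Module.finrank ℝ (Submodule.span ℝ K)

/-! ### The table of inequalities -/

/-- The columns `A₀ A₁ | B | C₀ C₁ | A₀B A₁B | BC₀ BC₁ | A₀BC₀ A₀BC₁ A₁BC₀ A₁BC₁`. -/
def column : Fin 13 → MSet :=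
  ![⟨{.A 0}, by decide⟩, ⟨{.A 1}, by decide⟩,
    ⟨{.B}, by decide⟩,
    ⟨{.C 0}, by decide⟩, ⟨{.C 1}, by decide⟩,
    ⟨{.A 0, .B}, by decide⟩, ⟨{.A 1, .B}, by decide⟩,
    ⟨{.B, .C 0}, by decide⟩, ⟨{.B, .C 1}, by decide⟩,
    ⟨{.A 0, .B, .C 0}, by decide⟩, ⟨{.A 0, .B, .C 1}, by decide⟩,
    ⟨{.A 1, .B, .C 0}, by decide⟩, ⟨{.A 1, .B, .C 1}, by decide⟩]

/-- The coefficients of the ten inequalities (each of the form `≤ 0`). -/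
def table : Fin 10 → Fin 13 → ℤ :=
  ![![-1, 0,   -1,   0, 0,    1, 0,    0, 0,    0, 0, 0, 0],
    ![ 0, 0,    0,   0, 0,    1, 0,    0, 0,   -1, 0, 0, 0],
    ![ 1, 0,    0,   1, 0,    0, 0,    0, 0,   -1, 0, 0, 0],
    ![ 0, 0,    1,   0, 0,   -1, 0,   -1, 0,    1, 0, 0, 0],
    ![ 0, 1,    0,   1, 0,    1, -1,   0, 0,   -1, 0, 0, 0],
    ![ 0, 1,    0,   0, 1,    1, -1,   1, -1,  -1, 0, 0, 0],
    ![ 1, 0,    0,   1, 0,    0, 0,    0, 0,    0, -1, -1, 1],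
    ![ 1, 0,    0,   1, 0,   -1, 1,    0, 0,   -1, 1, 0, -1],
    ![ 1, 0,    0,   1, 0,   -1, 1,   -1, 1,    1, -1, -1, 0],
    ![ 0, 0,    0,   0, 0,    1, 0,    1, 0,   -1, -1, -1, 1]]

/-- Row `k` of the table, as a family of coefficients on all 17 coordinates (the coefficients
of the `H(A_x C_z)` are zero). -/
def row (k : Fin 10) : MSet → ℤ := fun S => ∑ j, if column j = S then table k j else 0

/-- The left-hand side `∑ c_S H(X_S)` of the inequality with coefficients `c`. -/
def lhs (c : MSet → ℤ) (h : MSet → ℝ) : ℝ := ∑ S, (c S : ℝ) * h S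

/-- The symmetries of the scenario: the permutations of the observables which map jointly
measurable sets to jointly measurable sets. -/
def symmetries : Subgroup (Equiv.Perm Obs) where
  carrier := {σ | ∀ S : Finset Obs, JointlyMeasurable (S.image σ) ↔ JointlyMeasurable S}
  mul_mem' := by
    intro σ τ hσ hτ S
    have h := hσ (S.image τ)
    rw [Finset.image_image] at h
    exact h.trans (hτ S)
  one_mem' := by
    intro S
    simp
  inv_mem' := by
    intro σ hσ S
    have h := hσ (S.image (σ⁻¹ : Equiv.Perm Obs))
    rw [Finset.image_image] at h
    simpa using h.symm

/-- The inequality obtained from `c` by relabelling the observables. -/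
def relabel (σ : symmetries) (c : MSet → ℤ) : MSet → ℤ := fun S =>
  c ⟨S.1.image σ.1, S.2.1.image _, (σ.2 S.1).2 S.2.2⟩

/-- All inequalities which arise from `c` by a symmetry. -/
def symmetryClass (c : MSet → ℤ) : Set (MSet → ℤ) := Set.range fun σ => relabel σ c

/-- All inequalities equivalent to one of the rows of the table. -/
def bilocalityInequalities : Set (MSet → ℤ) := ⋃ k, symmetryClass (row k)

/-! ### Boxes, bilocal models and their entropies -/

/-- A family of numbers `P(a,b,c|x,z)`. The outcome alphabets `α x`, `β`, `γ z` of the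
observables `A_x`, `B`, `C_z` may all be different. -/
abbrev Box (α : Fin 2 → Type*) (β : Type*) (γ : Fin 2 → Type*) :=
  ∀ x z : Fin 2, α x → β → γ z → ℝ

/-- A (discrete) probability distribution. -/
def IsProb {ι : Type*} (p : ι → ℝ) : Prop := (∀ i, 0 ≤ p i) ∧ HasSum p 1

/-- `P(a,b,c|x,z) = ∑ ρ₁(λ₁) ρ₂(λ₂) P(a|x,λ₁) P(b|λ₁,λ₂) P(c|z,λ₂)`, with hidden variables
that take arbitrarily many, possibly infinitely many, discrete values. -/
def IsBilocal {α : Fin 2 → Type*} {β : Type*} {γ : Fin 2 → Type*} (P : Box α β γ) : Prop :=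
  ∃ (L₁ L₂ : Type) (ρ₁ : L₁ → ℝ) (ρ₂ : L₂ → ℝ) (pA : ∀ x : Fin 2, L₁ → α x → ℝ)
    (pB : L₁ → L₂ → β → ℝ) (pC : ∀ z : Fin 2, L₂ → γ z → ℝ),
    IsProb ρ₁ ∧ IsProb ρ₂ ∧ (∀ x l₁, IsProb (pA x l₁)) ∧ (∀ l₁ l₂, IsProb (pB l₁ l₂)) ∧
    (∀ z l₂, IsProb (pC z l₂)) ∧
    ∀ x z a b c, HasSum
      (fun l : L₁ × L₂ => ρ₁ l.1 * ρ₂ l.2 * (pA x l.1 a * pB l.1 l.2 b * pC z l.2 c))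
      (P x z a b c)

section Entropy

variable {α : Fin 2 → Type*} {β : Type*} {γ : Fin 2 → Type*}
  [∀ x, Fintype (α x)] [Fintype β] [∀ z, Fintype (γ z)]

/-- A no-signaling box: a probability distribution for all settings, such that the joint
distribution of `A, B` is independent of `z` and the one of `B, C` is independent of `x`. (`B` has
only one setting.) -/
def IsNoSignaling (P : Box α β γ) : Prop :=
  (∀ x z, IsProb fun w : α x × β × γ z => P x z w.1 w.2.1 w.2.2) ∧
  (∀ x z z' a b, ∑ c, P x z a b c = ∑ c, P x z' a b c) ∧
  (∀ x x' z b c, ∑ a, P x z a b c = ∑ a, P x' z a b c)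

/-- `∑_b P(a,b,c|x,z) = P(a|x) P(c|z)`. -/
def HasIndependentAC (P : Box α β γ) : Prop :=
  ∀ x z a c, ∑ b, P x z a b c = (∑ b, ∑ c', P x z a b c') * (∑ a', ∑ b, P x z a' b c)

/-- Shannon entropy in bits. -/
noncomputable def shannonEntropy {ι : Type*} [Fintype ι] (p : ι → ℝ) : ℝ :=
  - ∑ i, p i * Real.logb 2 (p i)

/-- The outcomes of the observables in `S`, extracted from the outcomes of `A_x, B, C_z`. -/
def restrictOutcome (S : Finset Obs) (x z : Fin 2) (w : α x × β × γ z) :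
    Option (α x) × Option β × Option (γ z) :=
  (if Obs.A x ∈ S then some w.1 else none, if Obs.B ∈ S then some w.2.1 else none,
    if Obs.C z ∈ S then some w.2.2 else none)

open Classical in
/-- The entropy of the joint distribution of the outcomes of the observables in `S`, when the
settings `x` and `z` are chosen. -/
noncomputable def entropyIn (P : Box α β γ) (x z : Fin 2) (S : Finset Obs) : ℝ :=
  shannonEntropy fun y : Option (α x) × Option β × Option (γ z) =>
    ∑ w : α x × β × γ z, if restrictOutcome S x z w = y then P x z w.1 w.2.1 w.2.2 else 0

/-- `h` lists the joint entropies `H(X_S)` of all jointly measurable sets `S`: whatever settings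
`x, z` are used to measure `S`, the entropy of the outcomes is `h S`. Every `S` is measured
by some choice of settings, so that there is at most one such `h`. -/
def IsEntropyVector (P : Box α β γ) (h : MSet → ℝ) : Prop :=
  ∀ (S : MSet) (x z : Fin 2), S.1 ⊆ {Obs.A x, Obs.B, Obs.C z} → h S = entropyIn P x z S.1

end Entropy

/-! Validity. Submodularity along B extends measurable sets to all five observables, whose joint
entropy is at least H(A₀A₁) + H(C₀C₁); this gives short Shannon derivations of the ten rows
(`lhs_row_le_zero`). Symmetries preserve the cone, so whole classes follow.

Completeness. Instead of eliminating the unmeasured entropies, a point satisfying everything is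
written as a nonnegative combination of 20 rays, each of which is visibly the image of a point of
the Shannon cone (`exists_eq_sum_rayTable`). The rays are private bits, bits that B shares with one
side, and XOR rays: a bit known to a nonempty set S of the A_x, an independent bit known to a
nonempty set T of the C_z, and B equal to their sum. An XOR ray contributes 1 to I(A_x:C_z|B)
exactly for (x,z) in the rectangle S × T, and no other ray contributes. So the 2 × 2 matrix
I(A_x:C_z|B) has to be split into weighted rectangles, with budgets H(A_x|B) for the rows, H(C_z|B)
for the columns, and H(B) − max I(A_x:B) − max I(C_z:B) for the total. The remaining budgets pay for
private bits. The inequalities are what makes this possible (`exists_rectangles`).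

Facets. The sum of the rays on the face of a row satisfies every other inequality strictly
(`exists_tight_only_at_row`). A general fact on polyhedral cones turns such witnesses into the
bijection with facets (`bijOn_facets_polyhedralCone`).

Boxes. Entropies are treated as entropies of partitions of one finite probability space, where
submodularity follows from log t ≤ t − 1. A bilocal model produces a joint distribution of all five
observables with A₀A₁ independent of C₀C₁, hence a point of the cone. Rows 0–3 involve only one
choice of settings, so they need no such joint distribution. Eight explicit boxes of bits violate
the remaining classes, and the violation itself shows that they are not bilocal. -/

/-! ### Facets of polyhedral cones -/

section Polyhedral

variable {V ι : Type*} [AddCommGroup V] [Module ℝ V]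

/-- The cone cut out of a subspace by the inequalities `l c h ≤ 0`, `c ∈ I`. -/
def polyhedralCone (W : Submodule ℝ V) (I : Set ι) (l : ι → V →ₗ[ℝ] ℝ) : Set V :=
  {h | h ∈ W ∧ ∀ c ∈ I, l c h ≤ 0}

variable {W : Submodule ℝ V} {I : Set ι} {l : ι → V →ₗ[ℝ] ℝ}

/-- A point stays in the cone after a small move that preserves the tight inequalities. -/
theorem exists_add_smul_mem_polyhedralCone (hI : I.Finite) {p w : V}
    (hp : p ∈ polyhedralCone W I l) (hw : w ∈ W) (h : ∀ c ∈ I, l c p < 0 ∨ l c w = 0) :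
    ∃ ε : ℝ, 0 < ε ∧ p + ε • w ∈ polyhedralCone W I l := by
  have key : ∀ᶠ ε : ℝ in nhdsWithin 0 (Set.Ioi 0), ∀ c ∈ I, l c (p + ε • w) ≤ 0 := by
    rw [Filter.eventually_all_finite hI]
    intro c hc
    rcases h c hc with h | h
    · have : Filter.Tendsto (fun ε : ℝ => l c p + ε * l c w) (nhdsWithin 0 (Set.Ioi 0))
          (nhds (l c p + 0 * l c w)) :=
        ((continuous_const.add (continuous_id.mul continuous_const)).tendsto 0).mono_left
          nhdsWithin_le_nhds
      rw [zero_mul, add_zero] at this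
      filter_upwards [this.eventually (gt_mem_nhds h)] with ε hε
      simpa using hε.le
    · refine Filter.Eventually.of_forall fun ε => ?_
      simpa [h] using hp.2 c hc
  obtain ⟨ε, h1, h2⟩ := (key.and self_mem_nhdsWithin).exists
  exact ⟨ε, h2, W.add_mem hp.1 (W.smul_mem _ hw), h1⟩

/-- From a strict point one can move a little in every direction of `W`, so each vector of `W` is a
multiple of a difference of two points of the cone. -/
theorem span_polyhedralCone (hI : I.Finite) {p : V} (hp : p ∈ W) (h : ∀ c ∈ I, l c p < 0) :
    Submodule.span ℝ (polyhedralCone W I l) = W := by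
  have hpK : p ∈ polyhedralCone W I l := ⟨hp, fun c hc => (h c hc).le⟩
  refine le_antisymm (Submodule.span_le.2 fun x hx => hx.1) fun w hw => ?_
  obtain ⟨ε, hε, hm⟩ := exists_add_smul_mem_polyhedralCone hI hpK hw fun c hc => .inl (h c hc)
  have := Submodule.smul_mem _ ε⁻¹ (Submodule.sub_mem _ (Submodule.subset_span hm)
    (Submodule.subset_span hpK))
  rwa [add_sub_cancel_left, inv_smul_smul₀ hε.ne'] at this

theorem span_face_polyhedralCone (hI : I.Finite) {c : ι} {p : V} (hp : p ∈ W)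
    (hc : l c p = 0) (h : ∀ d ∈ I, d ≠ c → l d p < 0) :
    Submodule.span ℝ {x ∈ polyhedralCone W I l | l c x = 0} = W ⊓ LinearMap.ker (l c) := by
  have hpK : p ∈ polyhedralCone W I l := by
    refine ⟨hp, fun d hd => ?_⟩
    rcases eq_or_ne d c with rfl | hne
    · exact hc.le
    · exact (h d hd hne).le
  refine le_antisymm (Submodule.span_le.2 fun x hx => ⟨hx.1.1, hx.2⟩) fun w hw => ?_
  have hw0 : l c w = 0 := hw.2
  obtain ⟨ε, hε, hm⟩ := exists_add_smul_mem_polyhedralCone hI hpK hw.1 fun d hd => by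
    rcases eq_or_ne d c with rfl | hne
    · exact .inr hw0
    · exact .inl (h d hd hne)
  have hm' : p + ε • w ∈ {x ∈ polyhedralCone W I l | l c x = 0} := ⟨hm, by simp [hc, hw0]⟩
  have := Submodule.smul_mem _ ε⁻¹ (Submodule.sub_mem _ (Submodule.subset_span hm')
    (Submodule.subset_span (show p ∈ {x ∈ polyhedralCone W I l | l c x = 0} from ⟨hpK, hc⟩)))
  rwa [add_sub_cancel_left, inv_smul_smul₀ hε.ne'] at this

theorem finrank_inf_ker_add_one [FiniteDimensional ℝ V] (f : V →ₗ[ℝ] ℝ) {x : V} (hx : x ∈ W)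
    (hfx : f x ≠ 0) :
    Module.finrank ℝ ↥(W ⊓ LinearMap.ker f) + 1 = Module.finrank ℝ W := by
  have h1 := LinearMap.finrank_range_add_finrank_ker (f.domRestrict W)
  have h2 : LinearMap.range (f.domRestrict W) = ⊤ := by
    refine LinearMap.range_eq_top.2 fun r => ⟨(r / f x) • ⟨x, hx⟩, ?_⟩
    simp [hfx]
  have h3 : Module.finrank ℝ (LinearMap.ker (f.domRestrict W))
      = Module.finrank ℝ ↥(W ⊓ LinearMap.ker f) := by
    have : (LinearMap.ker (f.domRestrict W)).map W.subtype = W ⊓ LinearMap.ker f := by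
      ext y
      simp only [Submodule.mem_map, LinearMap.mem_ker, Submodule.mem_inf]
      constructor
      · rintro ⟨z, hz, rfl⟩
        exact ⟨z.2, hz⟩
      · rintro ⟨hy, hz⟩
        exact ⟨⟨y, hy⟩, hz, rfl⟩
    rw [← this]
    exact (Submodule.equivMapOfInjective _ W.injective_subtype _).finrank_eq
  rw [h2, finrank_top, Module.finrank_self, h3] at h1
  omega

/-- If every inequality has a point at which it is the only tight one, then the inequalities
correspond to the facets of the cone. -/
theorem bijOn_facets_polyhedralCone [FiniteDimensional ℝ V] (hI : I.Finite) (hne : I.Nontrivial)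
    (p : ι → V) (hpW : ∀ c ∈ I, p c ∈ W) (hp : ∀ c ∈ I, l c (p c) = 0)
    (h : ∀ c ∈ I, ∀ d ∈ I, d ≠ c → l d (p c) < 0) :
    Submodule.span ℝ (polyhedralCone W I l) = W ∧
    Set.BijOn (fun c => {x ∈ polyhedralCone W I l | l c x = 0}) I
      {F | IsFacet (polyhedralCone W I l) F} := by
  have hpK : ∀ c ∈ I, p c ∈ polyhedralCone W I l := fun c hc => by
    refine ⟨hpW c hc, fun d hd => ?_⟩
    rcases eq_or_ne d c with rfl | hne
    · exact (hp d hd).le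
    · exact (h c hc d hd hne).le
  have hspan : Submodule.span ℝ (polyhedralCone W I l) = W := by
    obtain ⟨a, ha, b, hb, hab⟩ := hne
    -- No inequality is tight at both of two different witnesses, so their sum is strict everywhere.
    refine span_polyhedralCone hI (W.add_mem (hpW a ha) (hpW b hb)) fun c hc => ?_
    rw [map_add]
    rcases eq_or_ne c a with rfl | hca
    · exact add_neg_of_nonpos_of_neg (hp c hc).le (h b hb c hc hab)
    · exact add_neg_of_neg_of_nonpos (h a ha c hc hca) ((hpK b hb).2 c hc)
  have hface : ∀ c ∈ I, Module.finrank ℝ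
      (Submodule.span ℝ {x ∈ polyhedralCone W I l | l c x = 0}) + 1 = Module.finrank ℝ W := by
    intro c hc
    rw [span_face_polyhedralCone hI (hpW c hc) (hp c hc) (h c hc)]
    obtain ⟨d, hd, hdc⟩ := hne.exists_ne c
    exact finrank_inf_ker_add_one _ (hpW d hd) (h d hd c hc hdc.symm).ne
  refine ⟨hspan, fun c hc => ⟨l c, fun x hx => hx.2 c hc, rfl, ?_⟩, fun c hc d hd hcd => ?_, ?_⟩
  · rw [hspan]
    exact hface c hc
  · by_contra hcd'
    have : p c ∈ {x ∈ polyhedralCone W I l | l d x = 0} := by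
      have hc' : p c ∈ {x ∈ polyhedralCone W I l | l c x = 0} := ⟨hpK c hc, hp c hc⟩
      exact (Set.ext_iff.1 hcd (p c)).1 hc'
    exact (h c hc d hd (Ne.symm hcd')).ne this.2
  · rintro F ⟨f, hf, rfl, hrank⟩
    rw [hspan] at hrank
    -- Some inequality is tight on the whole face cut out by `f`. Otherwise, for each `c` the face
    -- has a point strict for `c`; the sum of these points is interior relative to `W` and a zero of
    -- `f ≤ 0`, so `f` vanishes on `W` and its face is the whole cone, which has the wrong
    -- dimension.
    have hex : ∃ c ∈ I, ∀ x ∈ polyhedralCone W I l, f x = 0 → l c x = 0 := by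
      by_contra! hcon
      choose! q hqK hq0 hq using hcon
      have hsum : ∀ c ∈ I, l c (∑ d ∈ hI.toFinset, q d) < 0 := by
        intro c hc
        rw [map_sum]
        refine Finset.sum_neg' (fun d hd => (hqK d (hI.mem_toFinset.1 hd)).2 c hc)
          ⟨c, hI.mem_toFinset.2 hc, lt_of_le_of_ne ((hqK c hc).2 c hc) (hq c hc)⟩
      have hsW : ∑ d ∈ hI.toFinset, q d ∈ W :=
        W.sum_mem fun d hd => (hqK d (hI.mem_toFinset.1 hd)).1
      have hs0 : f (∑ d ∈ hI.toFinset, q d) = 0 := by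
        rw [map_sum]
        exact Finset.sum_eq_zero fun d hd => hq0 d (hI.mem_toFinset.1 hd)
      have hnonpos : ∀ w ∈ W, f w ≤ 0 := by
        intro w hw
        obtain ⟨ε, hε, hm⟩ := exists_add_smul_mem_polyhedralCone hI
          ⟨hsW, fun c hc => (hsum c hc).le⟩ hw fun c hc => .inl (hsum c hc)
        have := hf _ hm
        rw [map_add, hs0, zero_add, map_smul, smul_eq_mul] at this
        exact nonpos_of_mul_nonpos_right this hε
      have hzero : ∀ w ∈ W, f w = 0 := fun w hw =>
        le_antisymm (hnonpos w hw) (by simpa using hnonpos _ (W.neg_mem hw))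
      have : {x ∈ polyhedralCone W I l | f x = 0} = polyhedralCone W I l :=
        Set.sep_eq_self_iff_mem_true.2 fun x hx => hzero x hx.1
      rw [this, hspan] at hrank
      omega
    obtain ⟨c, hc, hsub⟩ := hex
    refine ⟨c, hc, ?_⟩
    -- One face lies in the other and the dimensions agree, so the spans coincide and `f` vanishes
    -- on the larger face too.
    have hle : Submodule.span ℝ {x ∈ polyhedralCone W I l | f x = 0}
        ≤ Submodule.span ℝ {x ∈ polyhedralCone W I l | l c x = 0} :=
      Submodule.span_mono fun x hx => ⟨hx.1, hsub x hx.1 hx.2⟩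
    have heq := Submodule.eq_of_le_of_finrank_eq hle
      (by have := hface c hc; omega)
    ext x
    refine ⟨fun hx => ⟨hx.1, ?_⟩, fun hx => ⟨hx.1, hsub x hx.1 hx.2⟩⟩
    have hx' : x ∈ Submodule.span ℝ {x ∈ polyhedralCone W I l | f x = 0} := by
      rw [heq]
      exact Submodule.subset_span hx
    have hker : Submodule.span ℝ {x ∈ polyhedralCone W I l | f x = 0} ≤ LinearMap.ker f :=
      Submodule.span_le.2 fun y hy => hy.2
    exact hker hx'

end Polyhedral

/-! ### The symmetries of the scenario -/

/-- The relabelling of the observables that shifts the settings of `A` by `x`, those of `C` by `z`,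
and then exchanges `A` and `C` if `s` is true. -/
def relabelObs (s : Bool) (x z : Fin 2) : Obs → Obs
  | .A i => if s then .C (i + x) else .A (i + x)
  | .B => .B
  | .C i => if s then .A (i + z) else .C (i + z)

theorem relabelObs_bijective (s : Bool) (x z : Fin 2) : (relabelObs s x z).Bijective := by
  revert s x z
  decide

theorem jointlyMeasurable_image_relabelObs (s : Bool) (x z : Fin 2) (S : Finset Obs) :
    JointlyMeasurable (S.image (relabelObs s x z)) ↔ JointlyMeasurable S := by
  revert s x z S
  decide +kernel

/-- `relabelObs` as an element of the group of symmetries. -/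
noncomputable def standardSymmetry (s : Bool) (x z : Fin 2) : symmetries :=
  ⟨Equiv.ofBijective _ (relabelObs_bijective s x z), jointlyMeasurable_image_relabelObs s x z⟩

theorem coe_standardSymmetry (s : Bool) (x z : Fin 2) :
    ⇑(standardSymmetry s x z).1 = relabelObs s x z := rfl

/-- The minimal sets that are not jointly measurable are the two pairs of settings, so a symmetry
can only preserve or exchange these pairs. This leaves eight permutations. -/
theorem exists_eq_standardSymmetry (σ : symmetries) : ∃ s x z, σ = standardSymmetry s x z := by
  obtain ⟨σ, hσ⟩ := σ
  have key : ∀ σ : Equiv.Perm Obs,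
      ¬ JointlyMeasurable (({.A 0, .A 1} : Finset Obs).image σ) →
      ¬ JointlyMeasurable (({.C 0, .C 1} : Finset Obs).image σ) →
      ∃ s x z, ∀ o, σ o = relabelObs s x z o := by
    decide +kernel
  obtain ⟨s, x, z, h⟩ := key σ (by rw [hσ]; decide) (by rw [hσ]; decide)
  exact ⟨s, x, z, Subtype.ext (Equiv.ext h)⟩

/-- The action of a symmetry on the jointly measurable sets. -/
def MSet.map (σ : symmetries) (S : MSet) : MSet :=
  ⟨S.1.image σ.1, S.2.1.image _, (σ.2 S.1).2 S.2.2⟩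

theorem MSet.map_map (σ τ : symmetries) (S : MSet) :
    MSet.map σ (MSet.map τ S) = MSet.map (σ * τ) S := by
  refine Subtype.ext ?_
  change (S.1.image τ.1).image σ.1 = S.1.image (σ.1 * τ.1 : Equiv.Perm Obs)
  rw [Finset.image_image]
  rfl

theorem MSet.map_one (S : MSet) : MSet.map 1 S = S := by
  refine Subtype.ext ?_
  change S.1.image (1 : Equiv.Perm Obs) = S.1
  simp

/-- The action of a symmetry on the jointly measurable sets, as a permutation. -/
def MSet.mapEquiv (σ : symmetries) : Equiv.Perm MSet where
  toFun := MSet.map σ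
  invFun := MSet.map σ⁻¹
  left_inv S := by rw [MSet.map_map, inv_mul_cancel, MSet.map_one]
  right_inv S := by rw [MSet.map_map, mul_inv_cancel, MSet.map_one]

theorem relabel_apply (σ : symmetries) (c : MSet → ℤ) (S : MSet) :
    relabel σ c S = c (MSet.map σ S) := rfl

theorem relabel_mul (σ τ : symmetries) (c : MSet → ℤ) :
    relabel (σ * τ) c = relabel τ (relabel σ c) := by
  funext S
  simp only [relabel_apply, MSet.map_map]

theorem relabel_one (c : MSet → ℤ) : relabel 1 c = c := by
  funext S
  rw [relabel_apply, MSet.map_one]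

theorem mem_symmetryClass_self (c : MSet → ℤ) : c ∈ symmetryClass c := ⟨1, relabel_one c⟩

theorem symmetryClass_eq_of_mem {c d : MSet → ℤ} (h : c ∈ symmetryClass d) :
    symmetryClass c = symmetryClass d := by
  obtain ⟨σ, rfl⟩ := h
  ext e
  constructor
  · rintro ⟨τ, rfl⟩
    exact ⟨σ * τ, relabel_mul σ τ d⟩
  · rintro ⟨τ, rfl⟩
    refine ⟨σ⁻¹ * τ, ?_⟩
    change relabel (σ⁻¹ * τ) (relabel σ d) = relabel τ d
    rw [← relabel_mul, mul_inv_cancel_left]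

/-- Relabelling the coefficients amounts to moving the point by the inverse symmetry. Statements
about a row thereby pass to its class. -/
theorem lhs_relabel (σ : symmetries) (c : MSet → ℤ) (h : MSet → ℝ) :
    lhs (relabel σ c) h = lhs c (fun S => h (MSet.map σ⁻¹ S)) := by
  unfold lhs
  refine Fintype.sum_equiv (MSet.mapEquiv σ) _ _ fun S => ?_
  change _ = (c (MSet.map σ S) : ℝ) * h (MSet.map σ⁻¹ (MSet.map σ S))
  rw [MSet.map_map, inv_mul_cancel, MSet.map_one, relabel_apply]

/-! ### Coefficients on the thirteen columns -/

/-- The coefficients on all jointly measurable sets which are given by `t` on the columns. -/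
def ofColumns (t : Fin 13 → ℤ) : MSet → ℤ := fun S => ∑ j, if column j = S then t j else 0

theorem row_eq (k : Fin 10) : row k = ofColumns (table k) := rfl

theorem column_injective : Function.Injective column := by decide +kernel

theorem ofColumns_column (t : Fin 13 → ℤ) (j : Fin 13) : ofColumns t (column j) = t j := by
  simp [ofColumns, column_injective.eq_iff]

theorem ofColumns_injective : Function.Injective ofColumns := fun t u h => by
  funext j
  rw [← ofColumns_column t, h, ofColumns_column]

theorem lhs_ofColumns (t : Fin 13 → ℤ) (h : MSet → ℝ) :
    lhs (ofColumns t) h = ∑ j, (t j : ℝ) * h (column j) := by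
  simp only [lhs, ofColumns, Int.cast_sum, Finset.sum_mul]
  rw [Finset.sum_comm]
  refine Finset.sum_congr rfl fun j _ => ?_
  rw [Finset.sum_eq_single (column j)]
  · simp
  · intro S _ hS
    simp [hS.symm]
  · simp

/-- The column of the image of a column under `relabelObs`. -/
def columnMap (s : Bool) (x z : Fin 2) : Fin 13 → Fin 13 :=
  let a (i : Fin 2) : Fin 13 := cond s ![3, 4] ![0, 1] (i + x)
  let c (i : Fin 2) : Fin 13 := cond s ![0, 1] ![3, 4] (i + z)
  let ab (i : Fin 2) : Fin 13 := cond s ![7, 8] ![5, 6] (i + x)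
  let bc (i : Fin 2) : Fin 13 := cond s ![5, 6] ![7, 8] (i + z)
  let abc (i j : Fin 2) : Fin 13 :=
    cond s (![![9, 10], ![11, 12]] (j + z) (i + x)) (![![9, 10], ![11, 12]] (i + x) (j + z))
  ![a 0, a 1, 2, c 0, c 1, ab 0, ab 1, bc 0, bc 1, abc 0 0, abc 0 1, abc 1 0, abc 1 1]

theorem column_columnMap (s : Bool) (x z : Fin 2) (j : Fin 13) :
    column (columnMap s x z j) = MSet.map (standardSymmetry s x z) (column j) := by
  refine Subtype.ext ?_
  change (column (columnMap s x z j)).1 = (column j).1.image (relabelObs s x z)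
  revert s x z j
  decide +kernel

theorem columnMap_bijective (s : Bool) (x z : Fin 2) : (columnMap s x z).Bijective := by
  revert s x z
  decide +kernel

theorem relabel_ofColumns (s : Bool) (x z : Fin 2) (t : Fin 13 → ℤ) :
    relabel (standardSymmetry s x z) (ofColumns t) = ofColumns fun j => t (columnMap s x z j) := by
  funext S
  rw [relabel_apply]
  refine (Fintype.sum_equiv (Equiv.ofBijective _ (columnMap_bijective s x z)) _ _ fun j => ?_).symm
  simp only [Equiv.ofBijective_apply, column_columnMap]
  exact if_congr (MSet.mapEquiv _).injective.eq_iff.symm rfl rfl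

theorem mem_symmetryClass_row {c : MSet → ℤ} {k : Fin 10} :
    c ∈ symmetryClass (row k) ↔
      ∃ s x z, c = ofColumns fun j => table k (columnMap s x z j) := by
  constructor
  · rintro ⟨σ, rfl⟩
    obtain ⟨s, x, z, rfl⟩ := exists_eq_standardSymmetry σ
    exact ⟨s, x, z, relabel_ofColumns s x z _⟩
  · rintro ⟨s, x, z, rfl⟩
    exact ⟨standardSymmetry s x z, relabel_ofColumns s x z _⟩

/-- All inequalities, as coefficients on the columns. -/
def columnInequalities : Finset (Fin 13 → ℤ) :=
  Finset.univ.image fun q : Fin 10 × Bool × Fin 2 × Fin 2 =>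
    fun j => table q.1 (columnMap q.2.1 q.2.2.1 q.2.2.2 j)

theorem bilocalityInequalities_eq : bilocalityInequalities = ofColumns '' columnInequalities := by
  ext c
  simp only [bilocalityInequalities, Set.mem_iUnion, mem_symmetryClass_row, columnInequalities,
    Finset.coe_image, Finset.coe_univ, Set.image_univ, Set.mem_image, Set.mem_range, Prod.exists]
  constructor
  · rintro ⟨k, s, x, z, rfl⟩
    exact ⟨_, ⟨k, s, x, z, rfl⟩, rfl⟩
  · rintro ⟨_, ⟨k, s, x, z, rfl⟩, rfl⟩
    exact ⟨k, s, x, z, rfl⟩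

theorem ncard_bilocalityInequalities : bilocalityInequalities.ncard = 52 := by
  rw [bilocalityInequalities_eq, Set.ncard_image_of_injective _ ofColumns_injective,
    Set.ncard_coe_finset]
  decide +kernel

theorem row_mem_bilocalityInequalities (k : Fin 10) : row k ∈ bilocalityInequalities :=
  Set.mem_iUnion.2 ⟨k, mem_symmetryClass_self _⟩

theorem eq_of_row_mem_symmetryClass {k m : Fin 10} (h : row k ∈ symmetryClass (row m)) :
    k = m := by
  have key : ∀ k m : Fin 10, ∀ s x z, (∀ j, table k j = table m (columnMap s x z j)) → k = m := by
    decide +kernel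
  obtain ⟨s, x, z, h⟩ := mem_symmetryClass_row.1 h
  exact key k m s x z (congr_fun (ofColumns_injective h))

theorem existsUnique_mem_symmetryClass {c : MSet → ℤ} (hc : c ∈ bilocalityInequalities) :
    ∃! k, c ∈ symmetryClass (row k) := by
  obtain ⟨k, hk⟩ := Set.mem_iUnion.1 hc
  refine ⟨k, hk, fun m hm => ?_⟩
  refine eq_of_row_mem_symmetryClass ?_
  rw [← symmetryClass_eq_of_mem hk, symmetryClass_eq_of_mem hm]
  exact mem_symmetryClass_self _

theorem ncard_symmetryClasses : (symmetryClass '' bilocalityInequalities).ncard = 10 := by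
  have h : symmetryClass '' bilocalityInequalities = Set.range fun k => symmetryClass (row k) := by
    ext X
    constructor
    · rintro ⟨c, hc, rfl⟩
      obtain ⟨k, hk⟩ := Set.mem_iUnion.1 hc
      exact ⟨k, (symmetryClass_eq_of_mem hk).symm⟩
    · rintro ⟨k, rfl⟩
      exact ⟨row k, row_mem_bilocalityInequalities k, rfl⟩
  rw [h, ← Set.image_univ, Set.ncard_image_of_injective _ fun k m hkm =>
    eq_of_row_mem_symmetryClass (by
      have : symmetryClass (row k) = symmetryClass (row m) := hkm
      rw [← this]
      exact mem_symmetryClass_self _)]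
  simp [Set.ncard_univ]

/-! ### The inequalities hold on the projected cone -/

theorem IsShannon.submod {h : Finset Obs → ℝ} (hh : IsShannon h) (S T : Finset Obs)
    {U I : Finset Obs} (hU : S ∪ T = U) (hI : S ∩ T = I) : h U + h I ≤ h S + h T := by
  subst hU hI
  exact hh.2.2 S T

theorem IsShannon.mono {h : Finset Obs → ℝ} (hh : IsShannon h) {S T : Finset Obs} (hST : S ⊆ T) :
    h S ≤ h T := hh.2.1 S T hST

theorem IsShannon.map {h : Finset Obs → ℝ} (hh : IsShannon h) (σ : Equiv.Perm Obs) :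
    IsShannon fun S => h (S.image σ) := by
  refine ⟨by simpa using hh.1, fun S T hST => hh.mono (Finset.image_subset_image hST),
    fun S T => ?_⟩
  simp only [Finset.image_union, Finset.image_inter _ _ σ.injective]
  exact hh.2.2 _ _

theorem bilocalShannonCone_map {h : Finset Obs → ℝ} (hh : h ∈ bilocalShannonCone)
    (σ : symmetries) : (fun S => h (S.image σ.1)) ∈ bilocalShannonCone := by
  refine ⟨hh.1.map σ.1, ?_⟩
  obtain ⟨s, x, z, rfl⟩ := exists_eq_standardSymmetry σ
  have key : ∀ s x z,
      (({.A 0, .A 1} : Finset Obs).image (relabelObs s x z) = {.A 0, .A 1} ∧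
        ({.C 0, .C 1} : Finset Obs).image (relabelObs s x z) = {.C 0, .C 1}) ∨
      (({.A 0, .A 1} : Finset Obs).image (relabelObs s x z) = {.C 0, .C 1} ∧
        ({.C 0, .C 1} : Finset Obs).image (relabelObs s x z) = {.A 0, .A 1}) := by
    decide +kernel
  have h2 := hh.2
  simp only [mutualInfo, Finset.image_union] at h2 ⊢
  rw [coe_standardSymmetry]
  rcases key s x z with ⟨h0, h1⟩ | ⟨h0, h1⟩
  · rw [h0, h1, h2]
  · rw [h0, h1, Finset.union_comm]
    linarith

/-- Independence is inherited by subsets of the observables of `A` and `C`. -/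
theorem map_union_of_mem_bilocalShannonCone {h : Finset Obs → ℝ} (hh : h ∈ bilocalShannonCone)
    {S T : Finset Obs} (hS : S ⊆ {.A 0, .A 1}) (hT : T ⊆ {.C 0, .C 1}) :
    h (S ∪ T) = h S + h T := by
  have hdisj : Disjoint ({.A 0, .A 1} : Finset Obs) {.C 0, .C 1} := by decide
  obtain ⟨hs, hi⟩ := hh
  unfold mutualInfo at hi
  have h1 := hs.submod S T rfl rfl
  rw [Finset.disjoint_iff_inter_eq_empty.1 (hdisj.mono hS hT), hs.1] at h1
  -- Subadditivity is one direction. For the other, the mutual information does not increase when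
  -- C₀C₁ is shrunk to `T` and then A₀A₁ to `S`.
  have h2 := hs.submod ({.A 0, .A 1} ∪ T) {.C 0, .C 1} (U := {.A 0, .A 1} ∪ {.C 0, .C 1}) (I := T)
    (by rw [Finset.union_assoc, Finset.union_eq_right.2 hT])
    (by rw [Finset.union_inter_distrib_right, Finset.disjoint_iff_inter_eq_empty.1 hdisj, Finset.empty_union,
      Finset.inter_eq_left.2 hT])
  have h3 := hs.submod (S ∪ T) {.A 0, .A 1} (U := {.A 0, .A 1} ∪ T) (I := S)
    (by rw [Finset.union_right_comm, Finset.union_eq_right.2 hS])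
    (by rw [Finset.union_inter_distrib_right, Finset.inter_eq_left.2 hS,
      Finset.disjoint_iff_inter_eq_empty.1 (hdisj.symm.mono_left hT), Finset.union_empty])
  linarith

/-- In rows 4–8 the auxiliary entropies of incompatible sets cancel on adding submodularity steps;
what remains is compared with H(A₀A₁) + H(C₀) in row 4 and with H(A₀A₁) + H(C₀C₁) in rows 5–8. Row 9
uses only that all five observables have a joint entropy, not independence. -/
theorem lhs_row_le_zero {h : Finset Obs → ℝ} (hh : h ∈ bilocalShannonCone) (k : Fin 10) :
    lhs (row k) (fun S => h S.1) ≤ 0 := by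
  have hs := hh.1
  have ind := map_union_of_mem_bilocalShannonCone hh (S := {.A 0, .A 1}) (T := {.C 0, .C 1})
    le_rfl le_rfl
  have ind0 := map_union_of_mem_bilocalShannonCone hh (S := {.A 0, .A 1}) (T := {.C 0})
    (by decide) (by decide)
  have ind00 := map_union_of_mem_bilocalShannonCone hh (S := {.A 0}) (T := {.C 0})
    (by decide) (by decide)
  have full := hs.mono (S := {.A 0, .A 1} ∪ {.C 0, .C 1}) (T := {.A 0, .A 1, .B, .C 0, .C 1})
    (by decide)
  have hA (x : Fin 2) := hs.submod {.A x, .B} {.A 0, .A 1} (U := {.A 0, .A 1, .B}) (I := {.A x})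
    (by revert x; decide) (by revert x; decide)
  have hC (z : Fin 2) := hs.submod {.B, .C z} {.C 0, .C 1} (U := {.B, .C 0, .C 1}) (I := {.C z})
    (by revert z; decide) (by revert z; decide)
  have hAAB (x z : Fin 2) := hs.submod {.A x, .B, .C z} {.A 0, .A 1, .B}
    (U := {.A 0, .A 1, .B, .C z}) (I := {.A x, .B})
    (by revert x z; decide) (by revert x z; decide)
  have hBCC (x z : Fin 2) := hs.submod {.A x, .B, .C z} {.B, .C 0, .C 1}
    (U := {.A x, .B, .C 0, .C 1}) (I := {.B, .C z})
    (by revert x z; decide) (by revert x z; decide)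
  have hABCC (x z : Fin 2) := hs.submod {.A 0, .A 1, .B, .C z} {.A x, .B, .C 0, .C 1}
    (U := {.A 0, .A 1, .B, .C 0, .C 1}) (I := {.A x, .B, .C z})
    (by revert x z; decide) (by revert x z; decide)
  rw [row_eq, lhs_ofColumns]
  revert k
  simp only [Fin.forall_fin_succ, Fin.sum_univ_succ, table, column, Matrix.cons_val_zero,
    Matrix.cons_val_succ, Matrix.cons_val_fin_one, Finset.sum_singleton, Int.cast_zero, Int.cast_one,
    Int.cast_neg, zero_mul, one_mul, neg_mul, zero_add, add_zero, Finset.univ_unique,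
    Fin.default_eq_zero, IsEmpty.forall_iff, and_true]
  refine ⟨?_, ?_, ?_, ?_, ?_, ?_, ?_, ?_, ?_, ?_⟩
  · have := hs.submod {.A 0} {.B} (U := {.A 0, .B}) (I := ∅) (by decide) (by decide)
    linarith [hs.1]
  · have := hs.mono (S := {.A 0, .B}) (T := {.A 0, .B, .C 0}) (by decide)
    linarith
  · have := hs.mono (S := {.A 0} ∪ {.C 0}) (T := {.A 0, .B, .C 0}) (by decide)
    linarith
  · have := hs.submod {.A 0, .B} {.B, .C 0} (U := {.A 0, .B, .C 0}) (I := {.B}) (by decide) (by decide)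
    linarith
  · have := hs.mono (S := {.A 0, .A 1} ∪ {.C 0}) (T := {.A 0, .A 1, .B, .C 0}) (by decide)
    linarith [hA 1, hAAB 0 0]
  · have := hs.submod {.A 0, .A 1, .B, .C 0} {.B, .C 0, .C 1}
      (U := {.A 0, .A 1, .B, .C 0, .C 1}) (I := {.B, .C 0}) (by decide) (by decide)
    linarith [hA 1, hC 1, hAAB 0 0]
  · linarith [hA 0, hC 0, hAAB 0 1, hABCC 1 1, hBCC 1 0]
  · linarith [hA 0, hC 0, hAAB 1 1, hABCC 0 1, hBCC 0 0]
  · linarith [hA 0, hC 0, hAAB 1 0, hABCC 0 0, hBCC 0 1]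
  · have h1 := hs.submod {.A 0, .B, .C 0} {.A 0, .B, .C 1} (U := {.A 0, .B, .C 0, .C 1})
      (I := {.A 0, .B}) (by decide) (by decide)
    have h2 := hs.submod {.A 0, .B, .C 0, .C 1} {.A 1, .B, .C 0}
      (U := {.A 0, .A 1, .B, .C 0, .C 1}) (I := {.B, .C 0}) (by decide) (by decide)
    have h3 := hs.mono (S := {.A 1, .B, .C 1}) (T := {.A 0, .A 1, .B, .C 0, .C 1}) (by decide)
    linarith

theorem lhs_le_zero_of_mem_bilocalShannonCone {h : Finset Obs → ℝ} (hh : h ∈ bilocalShannonCone)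
    {c : MSet → ℤ} (hc : c ∈ bilocalityInequalities) : lhs c (fun S => h S.1) ≤ 0 := by
  obtain ⟨k, σ, rfl⟩ := Set.mem_iUnion.1 hc
  change lhs (relabel σ (row k)) _ ≤ 0
  rw [lhs_relabel]
  exact lhs_row_le_zero (bilocalShannonCone_map hh σ⁻¹) k

theorem mutualInfoAC_of_mem_bilocalShannonCone {h : Finset Obs → ℝ}
    (hh : h ∈ bilocalShannonCone) (x z : Fin 2) : mutualInfoAC (fun S => h S.1) x z = 0 := by
  have := map_union_of_mem_bilocalShannonCone hh (S := {.A x}) (T := {.C z})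
    (by revert x; decide) (by revert z; decide)
  unfold mutualInfoAC
  exact sub_eq_zero.2 this.symm

/-! ### Decomposition into rays -/

/-- Start from the least admissible `p` and `q`; if their sum is below `L`, raise `p` as far as `U`
permits, then `q`. -/
theorem exists_bounded_add {P Q L U V W : ℝ} (hU : 0 ≤ U) (hPU : P ≤ U) (hV : 0 ≤ V)
    (hQV : Q ≤ V) (hW : 0 ≤ W) (hPW : P ≤ W) (hQW : Q ≤ W) (hPQ : P + Q ≤ W) (hLW : L ≤ W)
    (hL : L ≤ U + V) :
    ∃ p q : ℝ, 0 ≤ p ∧ P ≤ p ∧ p ≤ U ∧ 0 ≤ q ∧ Q ≤ q ∧ q ≤ V ∧ L ≤ p + q ∧ p + q ≤ W := by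
  obtain ⟨P', hP0, hP', hPU', hPW', hPQ'⟩ : ∃ P', 0 ≤ P' ∧ P ≤ P' ∧ P' ≤ U ∧ P' ≤ W ∧
      P' + Q ≤ W := by
    rcases le_total 0 P with h | h
    · exact ⟨P, h, le_rfl, hPU, hPW, hPQ⟩
    · exact ⟨0, le_rfl, h, hU, hW, by linarith⟩
  obtain ⟨Q', hQ0, hQ', hQV', hPQ''⟩ : ∃ Q', 0 ≤ Q' ∧ Q ≤ Q' ∧ Q' ≤ V ∧ P' + Q' ≤ W := by
    rcases le_total 0 Q with h | h
    · exact ⟨Q, h, le_rfl, hQV, hPQ'⟩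
    · exact ⟨0, le_rfl, h, hV, by linarith⟩
  rcases le_total L (P' + Q') with h | h
  · exact ⟨P', Q', hP0, hP', hPU', hQ0, hQ', hQV', h, hPQ''⟩
  rcases le_total (L - Q') U with h' | h'
  · exact ⟨L - Q', Q', by linarith, by linarith, h', hQ0, hQ', hQV', by linarith, by linarith⟩
  · exact ⟨U, L - U, hU, hPU, le_rfl, by linarith, by linarith, by linarith, by linarith,
      by linarith⟩

/-- A nonnegative `2 × 2` matrix is a sum of weighted rectangles, with bounds on the total weight
of the rectangles that meet a given row or column, and on the total weight of all rectangles. -/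
theorem exists_rectangles {j₀₀ j₀₁ j₁₀ j₁₁ a₀ a₁ c₀ c₁ m : ℝ}
    (h00 : 0 ≤ j₀₀) (h01 : 0 ≤ j₀₁) (h10 : 0 ≤ j₁₀) (h11 : 0 ≤ j₁₁)
    (a00 : j₀₀ ≤ a₀) (a01 : j₀₁ ≤ a₀) (a10 : j₁₀ ≤ a₁) (a11 : j₁₁ ≤ a₁)
    (c00 : j₀₀ ≤ c₀) (c01 : j₀₁ ≤ c₁) (c10 : j₁₀ ≤ c₀) (c11 : j₁₁ ≤ c₁)
    (n00 : j₀₀ + j₀₁ + j₁₀ - j₁₁ ≤ a₀ + c₀) (n01 : j₀₁ + j₀₀ + j₁₁ - j₁₀ ≤ a₀ + c₁)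
    (n10 : j₁₀ + j₀₀ + j₁₁ - j₀₁ ≤ a₁ + c₀) (n11 : j₁₁ + j₀₁ + j₁₀ - j₀₀ ≤ a₁ + c₁)
    (m00 : j₀₀ ≤ m) (m01 : j₀₁ ≤ m) (m10 : j₁₀ ≤ m) (m11 : j₁₁ ≤ m)
    (l00 : j₀₁ + j₁₀ - j₁₁ ≤ m) (l01 : j₀₀ + j₁₁ - j₁₀ ≤ m)
    (l10 : j₀₀ + j₁₁ - j₀₁ ≤ m) (l11 : j₀₁ + j₁₀ - j₀₀ ≤ m) :
    ∃ f r₀ r₁ k₀ k₁ s₀₀ s₀₁ s₁₀ s₁₁ : ℝ, 0 ≤ f ∧ 0 ≤ r₀ ∧ 0 ≤ r₁ ∧ 0 ≤ k₀ ∧ 0 ≤ k₁ ∧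
      0 ≤ s₀₀ ∧ 0 ≤ s₀₁ ∧ 0 ≤ s₁₀ ∧ 0 ≤ s₁₁ ∧
      j₀₀ = f + r₀ + k₀ + s₀₀ ∧ j₀₁ = f + r₀ + k₁ + s₀₁ ∧
      j₁₀ = f + r₁ + k₀ + s₁₀ ∧ j₁₁ = f + r₁ + k₁ + s₁₁ ∧
      f + r₀ + k₀ + k₁ + s₀₀ + s₀₁ ≤ a₀ ∧ f + r₁ + k₀ + k₁ + s₁₀ + s₁₁ ≤ a₁ ∧
      f + r₀ + r₁ + k₀ + s₀₀ + s₁₀ ≤ c₀ ∧ f + r₀ + r₁ + k₁ + s₀₁ + s₁₁ ≤ c₁ ∧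
      f + r₀ + r₁ + k₀ + k₁ + s₀₀ + s₀₁ + s₁₀ + s₁₁ ≤ m := by
  -- Here `l` is the smallest entry, `i` the opposite one, `j` and `k` the neighbours of `i` in its
  -- row and column. The full rectangle gets weight `l`, the row and column through `i` get `p` and
  -- `q`, single cells get the rest. The bounds on `p` and `q` say that the cells are nonnegative
  -- and the budgets are kept.
  have key : ∀ {i j k l a c : ℝ}, 0 ≤ l → l ≤ i → l ≤ j → l ≤ k → i ≤ a → j ≤ a → i ≤ c → k ≤ c →
      i + j + k - l ≤ a + c → i ≤ m → j + k - l ≤ m →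
      ∃ p q : ℝ, 0 ≤ p ∧ i + j - l - a ≤ p ∧ p ≤ j - l ∧ 0 ≤ q ∧ i + k - l - c ≤ q ∧ q ≤ k - l ∧
        i + j + k - 2 * l - m ≤ p + q ∧ p + q ≤ i - l := by
    intro i j k l a c _ _ _ _ _ _ _ _ _ _ _
    apply exists_bounded_add <;> linarith
  rcases le_total j₀₀ j₀₁ with u | u <;> rcases le_total j₁₀ j₁₁ with v | v
  · rcases le_total j₀₀ j₁₀ with w | w
    · obtain ⟨p, q, h1, h2, h3, h4, h5, h6, h7, h8⟩ := key (i := j₁₁) (j := j₁₀) (k := j₀₁)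
        (l := j₀₀) h00 (by linarith) w u a11 a10 c11 c01 (by linarith) m11 (by linarith)
      exact ⟨j₀₀, 0, p, 0, q, 0, j₀₁ - j₀₀ - q, j₁₀ - j₀₀ - p, j₁₁ - j₀₀ - p - q,
        by constructorm* _ ∧ _ <;> linarith⟩
    · obtain ⟨p, q, h1, h2, h3, h4, h5, h6, h7, h8⟩ := key (i := j₀₁) (j := j₀₀) (k := j₁₁)
        (l := j₁₀) h10 (by linarith) w v a01 a00 c01 c11 (by linarith) m01 (by linarith)
      exact ⟨j₁₀, p, 0, 0, q, j₀₀ - j₁₀ - p, j₀₁ - j₁₀ - p - q, 0, j₁₁ - j₁₀ - q,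
        by constructorm* _ ∧ _ <;> linarith⟩
  · rcases le_total j₀₀ j₁₁ with w | w
    · obtain ⟨p, q, h1, h2, h3, h4, h5, h6, h7, h8⟩ := key (i := j₁₁) (j := j₁₀) (k := j₀₁)
        (l := j₀₀) h00 w (by linarith) u a11 a10 c11 c01 (by linarith) m11 (by linarith)
      exact ⟨j₀₀, 0, p, 0, q, 0, j₀₁ - j₀₀ - q, j₁₀ - j₀₀ - p, j₁₁ - j₀₀ - p - q,
        by constructorm* _ ∧ _ <;> linarith⟩
    · obtain ⟨p, q, h1, h2, h3, h4, h5, h6, h7, h8⟩ := key (i := j₀₀) (j := j₀₁) (k := j₁₀)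
        (l := j₁₁) h11 w (by linarith) v a00 a01 c00 c10 (by linarith) m00 (by linarith)
      exact ⟨j₁₁, p, 0, q, 0, j₀₀ - j₁₁ - p - q, j₀₁ - j₁₁ - p, j₁₀ - j₁₁ - q, 0,
        by constructorm* _ ∧ _ <;> linarith⟩
  · rcases le_total j₀₁ j₁₀ with w | w
    · obtain ⟨p, q, h1, h2, h3, h4, h5, h6, h7, h8⟩ := key (i := j₁₀) (j := j₁₁) (k := j₀₀)
        (l := j₀₁) h01 w (by linarith) u a10 a11 c10 c00 (by linarith) m10 (by linarith)
      exact ⟨j₀₁, 0, p, q, 0, j₀₀ - j₀₁ - q, 0, j₁₀ - j₀₁ - p - q, j₁₁ - j₀₁ - p,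
        by constructorm* _ ∧ _ <;> linarith⟩
    · obtain ⟨p, q, h1, h2, h3, h4, h5, h6, h7, h8⟩ := key (i := j₀₁) (j := j₀₀) (k := j₁₁)
        (l := j₁₀) h10 w (by linarith) v a01 a00 c01 c11 (by linarith) m01 (by linarith)
      exact ⟨j₁₀, p, 0, 0, q, j₀₀ - j₁₀ - p, j₀₁ - j₁₀ - p - q, 0, j₁₁ - j₁₀ - q,
        by constructorm* _ ∧ _ <;> linarith⟩
  · rcases le_total j₀₁ j₁₁ with w | w
    · obtain ⟨p, q, h1, h2, h3, h4, h5, h6, h7, h8⟩ := key (i := j₁₀) (j := j₁₁) (k := j₀₀)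
        (l := j₀₁) h01 (by linarith) w u a10 a11 c10 c00 (by linarith) m10 (by linarith)
      exact ⟨j₀₁, 0, p, q, 0, j₀₀ - j₀₁ - q, 0, j₁₀ - j₀₁ - p - q, j₁₁ - j₀₁ - p,
        by constructorm* _ ∧ _ <;> linarith⟩
    · obtain ⟨p, q, h1, h2, h3, h4, h5, h6, h7, h8⟩ := key (i := j₀₀) (j := j₀₁) (k := j₁₀)
        (l := j₁₁) h11 (by linarith) w v a00 a01 c00 c10 (by linarith) m00 (by linarith)
      exact ⟨j₁₁, p, 0, q, 0, j₀₀ - j₁₁ - p - q, j₀₁ - j₁₁ - p, j₁₀ - j₁₁ - q, 0,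
        by constructorm* _ ∧ _ <;> linarith⟩

/-- `1` if `X` meets `U`, and `0` otherwise. -/
def meets (U X : Finset Obs) : ℕ := if Disjoint X U then 0 else 1

theorem meets_le_one (U X : Finset Obs) : meets U X ≤ 1 := by
  unfold meets
  split_ifs <;> omega

theorem meets_mono (U : Finset Obs) {X Y : Finset Obs} (h : X ⊆ Y) : meets U X ≤ meets U Y := by
  unfold meets
  split_ifs with h1 h2
  · omega
  · omega
  · exact absurd (Finset.disjoint_of_subset_left h ‹_›) h1
  · omega

theorem meets_union (U X Y : Finset Obs) : meets U (X ∪ Y) = max (meets U X) (meets U Y) := by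
  unfold meets
  simp only [Finset.disjoint_union_left]
  split_ifs <;> simp_all

/-- The joint entropies if the observables in `S` equal a uniform bit, those in `T` equal a second,
independent one, and those in `R` equal the sum of the two. -/
def twoBitEntropy (S T R X : Finset Obs) : ℕ := min 2 (meets S X + meets T X + meets R X)

/-- Each `meets U` is monotone and submodular, hence so is the sum of three, and truncation at 2
preserves both properties. -/
theorem isShannon_twoBitEntropy (S T R : Finset Obs) :
    IsShannon fun X => (twoBitEntropy S T R X : ℝ) := by
  refine ⟨by simp [twoBitEntropy, meets], fun X Y h => ?_, fun X Y => ?_⟩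
  · have h1 := meets_mono S h
    have h2 := meets_mono T h
    have h3 := meets_mono R h
    have : twoBitEntropy S T R X ≤ twoBitEntropy S T R Y := by
      unfold twoBitEntropy
      omega
    beta_reduce
    exact_mod_cast this
  · have key : twoBitEntropy S T R (X ∪ Y) + twoBitEntropy S T R (X ∩ Y)
        ≤ twoBitEntropy S T R X + twoBitEntropy S T R Y := by
      have hX (U : Finset Obs) := meets_mono U (Finset.inter_subset_left : X ∩ Y ⊆ X)
      have hY (U : Finset Obs) := meets_mono U (Finset.inter_subset_right : X ∩ Y ⊆ Y)
      have h1 (U : Finset Obs) := meets_le_one U X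
      have h2 (U : Finset Obs) := meets_le_one U Y
      have h3 := h1 S
      have h4 := h1 T
      have h5 := h1 R
      have h6 := h2 S
      have h7 := h2 T
      have h8 := h2 R
      have := hX S
      have := hX T
      have := hX R
      have := hY S
      have := hY T
      have := hY R
      simp only [twoBitEntropy, meets_union]
      generalize meets S (X ∩ Y) = i1, meets T (X ∩ Y) = i2, meets R (X ∩ Y) = i3 at *
      generalize meets S X = x1, meets T X = x2, meets R X = x3 at *
      generalize meets S Y = y1, meets T Y = y2, meets R Y = y3 at *
      omega
    beta_reduce
    exact_mod_cast key

/-- The extreme rays of the projected cone, as entropies of all sets of observables. -/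
def ray : Fin 20 → Finset Obs → ℕ :=
  ![twoBitEntropy {.A 0} ∅ ∅, twoBitEntropy {.A 1} ∅ ∅,
    twoBitEntropy {.C 0} ∅ ∅, twoBitEntropy {.C 1} ∅ ∅,
    twoBitEntropy ∅ ∅ {.B},
    twoBitEntropy {.A 0, .B} ∅ ∅, twoBitEntropy {.A 1, .B} ∅ ∅, twoBitEntropy {.A 0, .A 1, .B} ∅ ∅,
    twoBitEntropy ∅ {.B, .C 0} ∅, twoBitEntropy ∅ {.B, .C 1} ∅, twoBitEntropy ∅ {.B, .C 0, .C 1} ∅,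
    twoBitEntropy {.A 0, .A 1} {.C 0, .C 1} {.B},
    twoBitEntropy {.A 0} {.C 0, .C 1} {.B}, twoBitEntropy {.A 1} {.C 0, .C 1} {.B},
    twoBitEntropy {.A 0, .A 1} {.C 0} {.B}, twoBitEntropy {.A 0, .A 1} {.C 1} {.B},
    twoBitEntropy {.A 0} {.C 0} {.B}, twoBitEntropy {.A 0} {.C 1} {.B},
    twoBitEntropy {.A 1} {.C 0} {.B}, twoBitEntropy {.A 1} {.C 1} {.B}]

theorem ray_mem_bilocalShannonCone (i : Fin 20) :
    (fun X => (ray i X : ℝ)) ∈ bilocalShannonCone := by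
  constructor
  · fin_cases i <;> exact isShannon_twoBitEntropy _ _ _
  · have key : ∀ i, ray i {.A 0, .A 1} + ray i {.C 0, .C 1}
        = ray i ({.A 0, .A 1} ∪ {.C 0, .C 1}) := by decide +kernel
    unfold mutualInfo
    rw [sub_eq_zero]
    beta_reduce
    exact_mod_cast key i

/-- The values of `ray` on the columns. -/
def rayTable : Fin 20 → Fin 13 → ℕ :=
  ![![1, 0, 0, 0, 0, 1, 0, 0, 0, 1, 1, 0, 0], ![0, 1, 0, 0, 0, 0, 1, 0, 0, 0, 0, 1, 1],
    ![0, 0, 0, 1, 0, 0, 0, 1, 0, 1, 0, 1, 0], ![0, 0, 0, 0, 1, 0, 0, 0, 1, 0, 1, 0, 1],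
    ![0, 0, 1, 0, 0, 1, 1, 1, 1, 1, 1, 1, 1],
    ![1, 0, 1, 0, 0, 1, 1, 1, 1, 1, 1, 1, 1], ![0, 1, 1, 0, 0, 1, 1, 1, 1, 1, 1, 1, 1],
    ![1, 1, 1, 0, 0, 1, 1, 1, 1, 1, 1, 1, 1],
    ![0, 0, 1, 1, 0, 1, 1, 1, 1, 1, 1, 1, 1], ![0, 0, 1, 0, 1, 1, 1, 1, 1, 1, 1, 1, 1],
    ![0, 0, 1, 1, 1, 1, 1, 1, 1, 1, 1, 1, 1],
    ![1, 1, 1, 1, 1, 2, 2, 2, 2, 2, 2, 2, 2],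
    ![1, 0, 1, 1, 1, 2, 1, 2, 2, 2, 2, 2, 2], ![0, 1, 1, 1, 1, 1, 2, 2, 2, 2, 2, 2, 2],
    ![1, 1, 1, 1, 0, 2, 2, 2, 1, 2, 2, 2, 2], ![1, 1, 1, 0, 1, 2, 2, 1, 2, 2, 2, 2, 2],
    ![1, 0, 1, 1, 0, 2, 1, 2, 1, 2, 2, 2, 1], ![1, 0, 1, 0, 1, 2, 1, 1, 2, 2, 2, 1, 2],
    ![0, 1, 1, 1, 0, 1, 2, 2, 1, 2, 1, 2, 2], ![0, 1, 1, 0, 1, 1, 2, 1, 2, 1, 2, 2, 2]]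

theorem ray_column (i : Fin 20) (j : Fin 13) : ray i (column j).1 = rayTable i j := by
  revert i j
  decide +kernel

set_option maxHeartbeats 1000000 in
/-- A point that satisfies the inequalities is a nonnegative combination of the rays. -/
theorem exists_eq_sum_rayTable (v : Fin 13 → ℝ)
    (hv : ∀ k s x z, ∑ j, (table k (columnMap s x z j) : ℝ) * v j ≤ 0) :
    ∃ t : Fin 20 → ℝ, (∀ i, 0 ≤ t i) ∧ ∀ j, v j = ∑ i, t i * (rayTable i j : ℝ) := by
  have h (k : Fin 10) := hv k
  simp only [Bool.forall_bool, Fin.forall_fin_two] at h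
  have h0 := h 0
  have h1 := h 1
  have h2 := h 2
  have h3 := h 3
  have h4 := h 4
  have h5 := h 5
  have h6 := h 6
  have h7 := h 7
  have h8 := h 8
  have h9 := h 9
  clear h hv
  simp [table, columnMap, Fin.sum_univ_succ] at h0 h1 h2 h3 h4 h5 h6 h7 h8 h9
  casesm* _ ∧ _
  -- `α` is the smaller of I(A₀:B) and I(A₁:B), the amount that B shares with both settings of A;
  -- `β` is the analogue for C. Row 0 makes them nonnegative.
  obtain ⟨α, hα0, hα1, hα, hαM⟩ : ∃ α, α ≤ v 0 + v 2 - v 5 ∧ α ≤ v 1 + v 2 - v 6 ∧ 0 ≤ α ∧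
      (α = v 0 + v 2 - v 5 ∨ α = v 1 + v 2 - v 6) := by
    rcases le_total (v 0 + v 2 - v 5) (v 1 + v 2 - v 6) with h | h
    · exact ⟨_, le_rfl, h, by linarith, .inl rfl⟩
    · exact ⟨_, h, le_rfl, by linarith, .inr rfl⟩
  obtain ⟨β, hβ0, hβ1, hβ, hβM⟩ : ∃ β, β ≤ v 3 + v 2 - v 7 ∧ β ≤ v 4 + v 2 - v 8 ∧ 0 ≤ β ∧
      (β = v 3 + v 2 - v 7 ∨ β = v 4 + v 2 - v 8) := by
    rcases le_total (v 3 + v 2 - v 7) (v 4 + v 2 - v 8) with h | h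
    · exact ⟨_, le_rfl, h, by linarith, .inl rfl⟩
    · exact ⟨_, h, le_rfl, by linarith, .inr rfl⟩
  -- A sum minus the minimum is the maximum, so a bound by the total budget follows from its
  -- versions for the four choices of (x,z).
  have hm : ∀ {w : ℝ}, (w ≤ v 2 - (v 0 + v 2 - v 5) - (v 3 + v 2 - v 7)) →
      (w ≤ v 2 - (v 0 + v 2 - v 5) - (v 4 + v 2 - v 8)) →
      (w ≤ v 2 - (v 1 + v 2 - v 6) - (v 3 + v 2 - v 7)) →
      (w ≤ v 2 - (v 1 + v 2 - v 6) - (v 4 + v 2 - v 8)) →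
      w ≤ v 2 - (v 0 + v 2 - v 5 + (v 1 + v 2 - v 6) - α)
        - (v 3 + v 2 - v 7 + (v 4 + v 2 - v 8) - β) := by
    intro w _ _ _ _
    rcases hαM with h | h <;> rcases hβM with h' | h' <;> rw [h, h'] <;> linarith
  -- The side conditions are the inequalities themselves: row 3 gives nonnegative entries, row 1
  -- entries within the row and column budgets, row 9 the conditions `n`, rows 2, 4, 5 the
  -- conditions `m`, and rows 6, 7, 8 the conditions `l`, up to symmetry.
  obtain ⟨f, r₀, r₁, k₀, k₁, s₀₀, s₀₁, s₁₀, s₁₁, hf, hr₀, hr₁, hk₀, hk₁, hs₀₀, hs₀₁, hs₁₀, hs₁₁,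
      e₀₀, e₀₁, e₁₀, e₁₁, ha₀, ha₁, hc₀, hc₁, ht⟩ := exists_rectangles
    (j₀₀ := v 5 + v 7 - v 9 - v 2) (j₀₁ := v 5 + v 8 - v 10 - v 2)
    (j₁₀ := v 6 + v 7 - v 11 - v 2) (j₁₁ := v 6 + v 8 - v 12 - v 2)
    (a₀ := v 5 - v 2) (a₁ := v 6 - v 2) (c₀ := v 7 - v 2) (c₁ := v 8 - v 2)
    (m := v 2 - (v 0 + v 2 - v 5 + (v 1 + v 2 - v 6) - α)
        - (v 3 + v 2 - v 7 + (v 4 + v 2 - v 8) - β))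
    (by linarith) (by linarith) (by linarith) (by linarith)
    (by linarith) (by linarith) (by linarith) (by linarith)
    (by linarith) (by linarith) (by linarith) (by linarith)
    (by linarith) (by linarith) (by linarith) (by linarith)
    (by apply hm <;> linarith) (by apply hm <;> linarith)
    (by apply hm <;> linarith) (by apply hm <;> linarith)
    (by apply hm <;> linarith) (by apply hm <;> linarith)
    (by apply hm <;> linarith) (by apply hm <;> linarith)
  -- In the order of `ray`: leftover budgets for private bits of A, C and B, bits shared by B with A
  -- and with C, then the nine rectangles.
  refine ⟨![v 5 - v 2 - (f + r₀ + k₀ + k₁ + s₀₀ + s₀₁), v 6 - v 2 - (f + r₁ + k₀ + k₁ + s₁₀ + s₁₁),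
    v 7 - v 2 - (f + r₀ + r₁ + k₀ + s₀₀ + s₁₀), v 8 - v 2 - (f + r₀ + r₁ + k₁ + s₀₁ + s₁₁),
    v 2 - (v 0 + v 2 - v 5 + (v 1 + v 2 - v 6) - α) - (v 3 + v 2 - v 7 + (v 4 + v 2 - v 8) - β)
      - (f + r₀ + r₁ + k₀ + k₁ + s₀₀ + s₀₁ + s₁₀ + s₁₁),
    v 0 + v 2 - v 5 - α, v 1 + v 2 - v 6 - α, α, v 3 + v 2 - v 7 - β, v 4 + v 2 - v 8 - β, β,
    f, r₀, r₁, k₀, k₁, s₀₀, s₀₁, s₁₀, s₁₁], ?_, ?_⟩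
  · simp only [Fin.forall_fin_succ, Matrix.cons_val_zero, Matrix.cons_val_succ,
      IsEmpty.forall_iff, and_true, sub_nonneg]
    constructorm* _ ∧ _ <;> assumption
  · simp only [Fin.forall_fin_succ, Fin.sum_univ_succ, rayTable, Matrix.cons_val_zero,
      Matrix.cons_val_succ, Matrix.cons_val_fin_one, Finset.sum_singleton, Finset.univ_unique,
      Fin.default_eq_zero, IsEmpty.forall_iff, and_true, Nat.cast_zero, Nat.cast_one,
      Nat.cast_ofNat, mul_zero, mul_one, zero_add]
    simp only [Fin.isValue, Fin.succ_zero_eq_one, Fin.reduceSucc]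
    constructorm* _ ∧ _ <;> linarith only [e₀₀, e₀₁, e₁₀, e₁₁]

/-! ### The projected cone as a polyhedron -/

theorem sum_ray_mem_bilocalShannonCone {t : Fin 20 → ℝ} (ht : ∀ i, 0 ≤ t i) :
    (fun X => ∑ i, t i * (ray i X : ℝ)) ∈ bilocalShannonCone := by
  have hr := ray_mem_bilocalShannonCone
  refine ⟨⟨?_, fun X Y h => ?_, fun X Y => ?_⟩, ?_⟩
  · exact Finset.sum_eq_zero fun i _ => mul_eq_zero_of_right _ (hr i).1.1
  · exact Finset.sum_le_sum fun i _ => mul_le_mul_of_nonneg_left ((hr i).1.mono h) (ht i)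
  · simp only [← Finset.sum_add_distrib, ← mul_add]
    exact Finset.sum_le_sum fun i _ => mul_le_mul_of_nonneg_left ((hr i).1.2.2 X Y) (ht i)
  · simp only [mutualInfo, ← Finset.sum_add_distrib, ← Finset.sum_sub_distrib, ← mul_add,
      ← mul_sub]
    exact Finset.sum_eq_zero fun i _ => mul_eq_zero_of_right _ (hr i).2

/-- The subspace of the four independence equations. -/
def independentSubspace : Submodule ℝ (MSet → ℝ) where
  carrier := {h | ∀ x z, mutualInfoAC h x z = 0}
  zero_mem' := by simp [mutualInfoAC]
  add_mem' := by
    intro g h hg hh x z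
    have h1 := hg x z
    have h2 := hh x z
    simp only [mutualInfoAC, Pi.add_apply] at h1 h2 ⊢
    linarith
  smul_mem' := by
    intro r h hh x z
    have h1 := hh x z
    simp only [mutualInfoAC, Pi.smul_apply, smul_eq_mul] at h1 ⊢
    rw [← mul_add, ← mul_sub, h1, mul_zero]

/-- `lhs c` as a linear map. -/
def lhsLinear (c : MSet → ℤ) : (MSet → ℝ) →ₗ[ℝ] ℝ where
  toFun := lhs c
  map_add' g h := by simp [lhs, mul_add, Finset.sum_add_distrib]
  map_smul' r h := by
    simp only [lhs, Pi.smul_apply, smul_eq_mul, RingHom.id_apply, Finset.mul_sum]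
    exact Finset.sum_congr rfl fun S _ => by ring

theorem finite_bilocalityInequalities : bilocalityInequalities.Finite :=
  Set.finite_of_ncard_ne_zero (by rw [ncard_bilocalityInequalities]; norm_num)

theorem relabel_mem_bilocalityInequalities {c : MSet → ℤ} (hc : c ∈ bilocalityInequalities)
    (σ : symmetries) : relabel σ c ∈ bilocalityInequalities := by
  obtain ⟨k, τ, rfl⟩ := Set.mem_iUnion.1 hc
  exact Set.mem_iUnion.2 ⟨k, τ * σ, relabel_mul τ σ _⟩

theorem eq_column_or_eq_AC (S : MSet) :
    (∃ j, column j = S) ∨ ∃ x z, S = ⟨{.A x, .C z}, AC_mem x z⟩ := by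
  revert S
  decide +kernel

theorem eq_of_column_eq {g h : MSet → ℝ} (hg : g ∈ independentSubspace)
    (hh : h ∈ independentSubspace) (hgh : ∀ j, g (column j) = h (column j)) : g = h := by
  funext S
  have hA : ∀ x, ∃ j, column j = ⟨{.A x}, A_mem x⟩ := by decide +kernel
  have hC : ∀ z, ∃ j, column j = ⟨{.C z}, C_mem z⟩ := by decide +kernel
  rcases eq_column_or_eq_AC S with ⟨j, rfl⟩ | ⟨x, z, rfl⟩
  · exact hgh j
  · have h1 := hg x z
    have h2 := hh x z
    obtain ⟨i, hi⟩ := hA x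
    obtain ⟨j, hj⟩ := hC z
    unfold mutualInfoAC at h1 h2
    rw [← hi, ← hj] at h1 h2
    linarith [hgh i, hgh j]

/-- For the reverse inclusion, the ray combination lies in the Shannon cone and matches the point on
the columns; the four equations fix the coordinates H(A_x C_z). -/
theorem marginalCone_eq :
    marginalCone = polyhedralCone independentSubspace bilocalityInequalities lhsLinear := by
  ext h
  constructor
  · rintro ⟨h, hh, rfl⟩
    exact ⟨mutualInfoAC_of_mem_bilocalShannonCone hh,
      fun c hc => lhs_le_zero_of_mem_bilocalShannonCone hh hc⟩
  · rintro ⟨hW, hI⟩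
    obtain ⟨t, ht, htv⟩ := exists_eq_sum_rayTable (fun j => h (column j)) fun k s x z => by
      rw [← lhs_ofColumns fun j => table k (columnMap s x z j)]
      exact hI _ (Set.mem_iUnion.2 ⟨k, mem_symmetryClass_row.2 ⟨s, x, z, rfl⟩⟩)
    have hΓ := sum_ray_mem_bilocalShannonCone ht
    refine ⟨_, hΓ, eq_of_column_eq (mutualInfoAC_of_mem_bilocalShannonCone hΓ) hW fun j => ?_⟩
    rw [htv j]
    exact Finset.sum_congr rfl fun i _ => by rw [ray_column]

theorem lhs_ray (d : Fin 13 → ℤ) (i : Fin 20) :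
    lhs (ofColumns d) (fun S => (ray i S.1 : ℝ)) = ((∑ j, d j * (rayTable i j : ℤ) : ℤ) : ℝ) := by
  rw [lhs_ofColumns]
  push_cast
  exact Finset.sum_congr rfl fun j _ => by rw [ray_column]

/-- A single ray on the face of the row separates it from a given other inequality; in integers this
is a finite check. -/
theorem exists_ray_tight_strict (k : Fin 10) {d : Fin 13 → ℤ} (hd : d ∈ columnInequalities)
    (hne : d ≠ table k) : ∃ i, ∑ j, table k j * (rayTable i j : ℤ) = 0 ∧
      ∑ j, d j * (rayTable i j : ℤ) < 0 := by
  have key : ∀ k, ∀ d ∈ columnInequalities, d ≠ table k →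
      ∃ i, ∑ j, table k j * (rayTable i j : ℤ) = 0 ∧ ∑ j, d j * (rayTable i j : ℤ) < 0 := by
    decide +kernel
  exact key k d hd hne

/-- The sum of the rays on the face of a row lies on no other face. -/
theorem exists_tight_only_at_row (k : Fin 10) : ∃ h ∈ bilocalShannonCone,
    lhs (row k) (fun S => h S.1) = 0 ∧
    ∀ d ∈ bilocalityInequalities, d ≠ row k → lhs d (fun S => h S.1) < 0 := by
  let t : Fin 20 → ℝ := fun i => if ∑ j, table k j * (rayTable i j : ℤ) = 0 then 1 else 0
  have hsum (d : MSet → ℤ) : lhs d (fun S => ∑ i, t i * (ray i S.1 : ℝ))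
      = ∑ i, t i * lhs d (fun S => (ray i S.1 : ℝ)) := by
    simp only [lhs, Finset.mul_sum]
    rw [Finset.sum_comm]
    exact Finset.sum_congr rfl fun i _ => Finset.sum_congr rfl fun S _ => by ring
  have ht : ∀ i, 0 ≤ t i := fun i => by
    simp only [t]
    split_ifs <;> norm_num
  refine ⟨_, sum_ray_mem_bilocalShannonCone ht, ?_, fun d hd hne => ?_⟩
  · rw [hsum]
    refine Finset.sum_eq_zero fun i _ => ?_
    rw [row_eq, lhs_ray]
    simp only [t]
    split_ifs with h
    · rw [h]
      simp
    · simp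
  · rw [hsum]
    have hd' := hd
    rw [bilocalityInequalities_eq] at hd'
    obtain ⟨e, he, rfl⟩ := hd'
    obtain ⟨i, hi, hlt⟩ := exists_ray_tight_strict k he fun h => hne (by rw [h, row_eq])
    refine Finset.sum_neg' (fun i _ => mul_nonpos_of_nonneg_of_nonpos (ht i)
      (lhs_le_zero_of_mem_bilocalShannonCone (ray_mem_bilocalShannonCone i) hd))
      ⟨i, Finset.mem_univ _, ?_⟩
    rw [lhs_ray]
    simp only [t, if_pos hi, one_mul]
    exact_mod_cast hlt

theorem exists_tight_only_at (c : MSet → ℤ) (hc : c ∈ bilocalityInequalities) :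
    ∃ h ∈ independentSubspace, lhsLinear c h = 0 ∧
      ∀ d ∈ bilocalityInequalities, d ≠ c → lhsLinear d h < 0 := by
  obtain ⟨k, σ, rfl⟩ := Set.mem_iUnion.1 hc
  obtain ⟨h, hh, h0, hlt⟩ := exists_tight_only_at_row k
  have hrel (d : MSet → ℤ) : lhs d (fun S => h (S.1.image σ.1))
      = lhs (relabel σ⁻¹ d) (fun S => h S.1) := by
    rw [lhs_relabel, inv_inv]
    rfl
  have hinv (d : MSet → ℤ) : relabel σ (relabel σ⁻¹ d) = d := by
    rw [← relabel_mul, inv_mul_cancel, relabel_one]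
  refine ⟨_, mutualInfoAC_of_mem_bilocalShannonCone (bilocalShannonCone_map hh σ), ?_,
    fun d hd hne => ?_⟩
  · change lhs (relabel σ (row k)) (fun S => h (S.1.image σ.1)) = 0
    rw [hrel, ← relabel_mul, mul_inv_cancel, relabel_one, h0]
  · change lhs d (fun S => h (S.1.image σ.1)) < 0
    rw [hrel]
    refine hlt _ (relabel_mem_bilocalityInequalities hd _) fun heq => hne ?_
    rw [← hinv d, heq]

theorem span_and_facets_marginalCone :
    Submodule.span ℝ marginalCone = independentSubspace ∧
    Set.BijOn (fun c => {h ∈ marginalCone | lhs c h = 0}) bilocalityInequalities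
      {F | IsFacet marginalCone F} := by
  choose! p hpW hp hlt using exists_tight_only_at
  rw [marginalCone_eq]
  exact bijOn_facets_polyhedralCone finite_bilocalityInequalities
    (Set.one_lt_ncard_iff_nontrivial_and_finite.1
      (by rw [ncard_bilocalityInequalities]; norm_num)).1 p hpW hp hlt

/-! ### Entropies of partitions of a finite probability space -/

section PartitionEntropy

variable {Ω : Type*} [Fintype Ω]

open Classical in
/-- The weight of the cell of `w`. -/
noncomputable def cellWeight (p : Ω → ℝ) (r : Setoid Ω) (w : Ω) : ℝ :=
  ∑ w', if r w w' then p w' else 0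

/-- The entropy of the partition given by `r`. -/
noncomputable def partitionEntropy (p : Ω → ℝ) (r : Setoid Ω) : ℝ :=
  - ∑ w, p w * Real.logb 2 (cellWeight p r w)

variable {p : Ω → ℝ} {r s : Setoid Ω}

theorem cellWeight_nonneg (hp : ∀ w, 0 ≤ p w) (r : Setoid Ω) (w : Ω) : 0 ≤ cellWeight p r w :=
  Finset.sum_nonneg fun w' _ => by split_ifs <;> simp [hp]

theorem cellWeight_congr {w w' : Ω} (h : r w w') : cellWeight p r w = cellWeight p r w' := by
  classical
  refine Finset.sum_congr rfl fun v _ => if_congr ?_ rfl rfl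
  exact ⟨fun h' => r.trans' (r.symm' h) h', fun h' => r.trans' h h'⟩

theorem le_cellWeight (hp : ∀ w, 0 ≤ p w) (r : Setoid Ω) (w : Ω) : p w ≤ cellWeight p r w := by
  classical
  have h := Finset.single_le_sum (s := Finset.univ) (f := fun w' => if r w w' then p w' else 0)
    (fun w' _ => by split_ifs <;> simp [hp]) (Finset.mem_univ w)
  simp only [r.refl' w, if_true] at h
  unfold cellWeight
  convert h

theorem cellWeight_mono (hp : ∀ w, 0 ≤ p w) (h : r ≤ s) (w : Ω) :
    cellWeight p r w ≤ cellWeight p s w := by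
  refine Finset.sum_le_sum fun v _ => ?_
  by_cases hv : r w v
  · rw [if_pos hv, if_pos (h hv)]
  · rw [if_neg hv]
    split_ifs <;> simp [hp]

theorem partitionEntropy_mono (hp : ∀ w, 0 ≤ p w) (h : r ≤ s) :
    partitionEntropy p s ≤ partitionEntropy p r := by
  refine neg_le_neg (Finset.sum_le_sum fun w _ => ?_)
  rcases (hp w).eq_or_lt with h0 | h0
  · simp [← h0]
  · exact mul_le_mul_of_nonneg_left (Real.logb_le_logb_of_le one_lt_two
      (h0.trans_le (le_cellWeight hp r w)) (cellWeight_mono hp h w)) h0.le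

theorem partitionEntropy_top (hp : ∑ w, p w = 1) : partitionEntropy p ⊤ = 0 := by
  have : ∀ w, cellWeight p ⊤ w = 1 := fun w => by
    rw [← hp]
    exact Finset.sum_congr rfl fun v _ => if_pos trivial
  simp [partitionEntropy, this]

theorem partitionEntropy_of_mul (hp : ∀ w, 0 ≤ p w) {u : Setoid Ω}
    (h : ∀ w, cellWeight p u w = cellWeight p r w * cellWeight p s w) :
    partitionEntropy p u = partitionEntropy p r + partitionEntropy p s := by
  unfold partitionEntropy
  rw [← neg_add, ← Finset.sum_add_distrib]
  refine congrArg _ (Finset.sum_congr rfl fun w _ => ?_)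
  rcases (hp w).eq_or_lt with h0 | h0
  · simp [← h0]
  · rw [h, Real.logb_mul (h0.trans_le (le_cellWeight hp r w)).ne'
      (h0.trans_le (le_cellWeight hp s w)).ne', mul_add]

/-- With P_t the cell weight for `t`, the ratio P_r P_s / (P_u P_i) has expectation at most 1, and
log t ≤ t − 1 concludes. Any common coarsening `i` is allowed, since the partition of `S ∩ T` need
not be the join of those of `S` and `T`. -/
theorem partitionEntropy_submodular (hp : ∀ w, 0 ≤ p w) {i : Setoid Ω} (hr : r ≤ i) (hs : s ≤ i) :
    partitionEntropy p (r ⊓ s) + partitionEntropy p i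
      ≤ partitionEntropy p r + partitionEntropy p s := by
  classical
  set u := r ⊓ s with hu
  have hcell := fun (t : Setoid Ω) w => cellWeight_nonneg hp t w
  -- The `r`-cell of `a` and the `s`-cell of `b` are disjoint or meet in exactly one cell of `u`.
  -- Cells of weight 0 do no harm because `0 / 0 = 0`.
  have hinner : ∀ a b, ∑ w, (if r w a ∧ s w b then
        p w / (cellWeight p u w * cellWeight p i w) else 0)
      ≤ if i a b then 1 / cellWeight p i a else 0 := by
    intro a b
    by_cases hex : ∃ w₀, r w₀ a ∧ s w₀ b
    · obtain ⟨w₀, h1, h2⟩ := hex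
      rw [if_pos (i.trans' (i.symm' (hr h1)) (hs h2)), ← cellWeight_congr (hr h1)]
      have : ∀ w, (if r w a ∧ s w b then p w / (cellWeight p u w * cellWeight p i w) else 0)
          = (if u w₀ w then p w else 0) / (cellWeight p u w₀ * cellWeight p i w₀) := by
        intro w
        have hiff : (r w a ∧ s w b) ↔ u w₀ w := by
          change r w a ∧ s w b ↔ r w₀ w ∧ s w₀ w
          exact ⟨fun h => ⟨r.trans' h1 (r.symm' h.1), s.trans' h2 (s.symm' h.2)⟩,
            fun h => ⟨r.trans' (r.symm' h.1) h1, s.trans' (s.symm' h.2) h2⟩⟩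
        by_cases hw : u w₀ w
        · rw [if_pos (hiff.2 hw), if_pos hw, cellWeight_congr hw,
            cellWeight_congr (r := i) (hr (inf_le_left (a := r) (b := s) hw))]
        · rw [if_neg (hiff.not.2 hw), if_neg hw, zero_div]
      simp only [this]
      rw [← Finset.sum_div]
      have hsum : (∑ w, if u w₀ w then p w else 0) = cellWeight p u w₀ := by
        unfold cellWeight
        congr! 1
      rw [hsum, ← div_div]
      exact div_le_div_of_nonneg_right (div_self_le_one _) (hcell i w₀)
    · rw [Finset.sum_eq_zero fun w _ => if_neg fun h => hex ⟨w, h⟩]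
      split_ifs
      · exact one_div_nonneg.2 (hcell i a)
      · exact le_rfl
  have hcellsum : ∀ (t : Setoid Ω) w, cellWeight p t w = ∑ a, if t w a then p a else 0 := by
    intro t w
    unfold cellWeight
    congr! 1
  have htotal : ∑ w, p w * (cellWeight p r w * cellWeight p s w /
      (cellWeight p u w * cellWeight p i w)) ≤ ∑ w, p w := by
    calc ∑ w, p w * (cellWeight p r w * cellWeight p s w / (cellWeight p u w * cellWeight p i w))
        = ∑ w, ∑ a, ∑ b, p a * p b * (if r w a ∧ s w b then
            p w / (cellWeight p u w * cellWeight p i w) else 0) := by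
          refine Finset.sum_congr rfl fun w _ => ?_
          rw [hcellsum r, hcellsum s, Finset.sum_mul_sum, Finset.sum_div, Finset.mul_sum]
          refine Finset.sum_congr rfl fun a _ => ?_
          rw [Finset.sum_div, Finset.mul_sum]
          refine Finset.sum_congr rfl fun b _ => ?_
          by_cases h1 : r w a <;> by_cases h2 : s w b <;> simp [h1, h2]
          ring
      _ = ∑ a, ∑ b, p a * p b * ∑ w, (if r w a ∧ s w b then
            p w / (cellWeight p u w * cellWeight p i w) else 0) := by
          rw [Finset.sum_comm]
          refine Finset.sum_congr rfl fun a _ => ?_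
          rw [Finset.sum_comm]
          simp only [Finset.mul_sum]
      _ ≤ ∑ a, ∑ b, p a * p b * (if i a b then 1 / cellWeight p i a else 0) :=
          Finset.sum_le_sum fun a _ => Finset.sum_le_sum fun b _ =>
            mul_le_mul_of_nonneg_left (hinner a b) (mul_nonneg (hp a) (hp b))
      _ = ∑ a, p a * (cellWeight p i a / cellWeight p i a) := by
          refine Finset.sum_congr rfl fun a _ => ?_
          nth_rewrite 2 [hcellsum i]
          rw [Finset.sum_div, Finset.mul_sum]
          refine Finset.sum_congr rfl fun b _ => ?_
          split_ifs <;> ring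
      _ ≤ ∑ a, p a := Finset.sum_le_sum fun a _ =>
          mul_le_of_le_one_right (hp a) (div_self_le_one _)
  have hlog : ∀ w, p w * (Real.log (cellWeight p r w) + Real.log (cellWeight p s w)
      - Real.log (cellWeight p u w) - Real.log (cellWeight p i w))
      ≤ p w * (cellWeight p r w * cellWeight p s w /
      (cellWeight p u w * cellWeight p i w)) - p w := by
    intro w
    rcases (hp w).eq_or_lt with h0 | h0
    · simp [← h0]
    · have hpos := fun t : Setoid Ω => h0.trans_le (le_cellWeight hp t w)
      have h1 := Real.log_le_sub_one_of_pos (div_pos (mul_pos (hpos r) (hpos s))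
        (mul_pos (hpos u) (hpos i)))
      rw [Real.log_div (mul_pos (hpos r) (hpos s)).ne' (mul_pos (hpos u) (hpos i)).ne',
        Real.log_mul (hpos r).ne' (hpos s).ne', Real.log_mul (hpos u).ne' (hpos i).ne'] at h1
      nlinarith [mul_le_mul_of_nonneg_left h1 h0.le]
  have hmain := Finset.sum_le_sum fun w (_ : w ∈ Finset.univ) => hlog w
  rw [Finset.sum_sub_distrib] at hmain
  have hneg := hmain.trans (sub_nonpos.2 htotal)
  have heq : partitionEntropy p u + partitionEntropy p i - (partitionEntropy p r
      + partitionEntropy p s) = (∑ w, p w * (Real.log (cellWeight p r w)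
      + Real.log (cellWeight p s w) - Real.log (cellWeight p u w)
      - Real.log (cellWeight p i w))) / Real.log 2 := by
    simp only [partitionEntropy, Real.logb, mul_sub, mul_add, Finset.sum_sub_distrib,
      Finset.sum_add_distrib, ← mul_div_assoc, ← Finset.sum_div]
    ring
  have := div_nonpos_of_nonpos_of_nonneg hneg (Real.log_nonneg one_le_two)
  rw [← heq] at this
  linarith

open Classical in
/-- The image of a weight under a map. -/
noncomputable def pushWeight {Ω' : Type*} (f : Ω → Ω') (p : Ω → ℝ) (y : Ω') : ℝ :=
  ∑ w, if f w = y then p w else 0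

theorem sum_pushWeight_mul {Ω' : Type*} [Fintype Ω'] (f : Ω → Ω') (p : Ω → ℝ) (g : Ω' → ℝ) :
    ∑ y, pushWeight f p y * g y = ∑ w, p w * g (f w) := by
  unfold pushWeight
  simp only [Finset.sum_mul, ite_mul, zero_mul]
  rw [Finset.sum_comm]
  refine Finset.sum_congr rfl fun w _ => ?_
  rw [Finset.sum_eq_single (f w) (fun y _ hy => if_neg hy.symm) (fun h => absurd (Finset.mem_univ _) h),
    if_pos rfl]

theorem partitionEntropy_pushWeight {Ω' : Type*} [Fintype Ω'] (f : Ω → Ω') (p : Ω → ℝ)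
    (r : Setoid Ω') :
    partitionEntropy (pushWeight f p) r = partitionEntropy p (r.comap f) := by
  have hcell : ∀ w, cellWeight (pushWeight f p) r (f w) = cellWeight p (r.comap f) w := by
    classical
    intro w
    have := sum_pushWeight_mul f p fun y => if r (f w) y then (1 : ℝ) else 0
    simp only [mul_ite, mul_one, mul_zero] at this
    unfold cellWeight
    convert this
    exact Setoid.comap_rel ..
  unfold partitionEntropy
  rw [sum_pushWeight_mul]
  simp only [hcell]

theorem shannonEntropy_pushWeight {ι : Type*} [Fintype ι] (f : Ω → ι) (p : Ω → ℝ) :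
    shannonEntropy (pushWeight f p) = partitionEntropy p (Setoid.ker f) := by
  classical
  unfold shannonEntropy partitionEntropy
  rw [sum_pushWeight_mul]
  refine congrArg _ (Finset.sum_congr rfl fun w _ => ?_)
  congr 2
  refine Finset.sum_congr rfl fun v _ => if_congr ?_ rfl rfl
  rw [Setoid.ker_def]
  exact eq_comm

end PartitionEntropy

/-- The common refinement of the partitions in `S`. -/
def jointSetoid {Ω ι : Type*} (r : ι → Setoid Ω) (S : Finset ι) : Setoid Ω where
  r w w' := ∀ o ∈ S, r o w w'
  iseqv := ⟨fun w o _ => (r o).refl' w, fun h o ho => (r o).symm' (h o ho),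
    fun h h' o ho => (r o).trans' (h o ho) (h' o ho)⟩

theorem jointSetoid_rel {Ω ι : Type*} (r : ι → Setoid Ω) (S : Finset ι) (w w' : Ω) :
    jointSetoid r S w w' ↔ ∀ o ∈ S, r o w w' := Iff.rfl

theorem jointSetoid_anti {Ω ι : Type*} (r : ι → Setoid Ω) {S T : Finset ι} (h : S ⊆ T) :
    jointSetoid r T ≤ jointSetoid r S := fun _ _ hw o ho => hw o (h ho)

theorem isShannon_partitionEntropy {Ω : Type*} [Fintype Ω] {p : Ω → ℝ} (hp : ∀ w, 0 ≤ p w) (hp1 : ∑ w, p w = 1)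
    (r : Obs → Setoid Ω) : IsShannon fun S => partitionEntropy p (jointSetoid r S) := by
  refine ⟨?_, fun S T h => partitionEntropy_mono hp (jointSetoid_anti r h), fun S T => ?_⟩
  · have : jointSetoid r ∅ = ⊤ := by
      refine eq_top_iff.2 fun w w' _ o ho => ?_
      simp at ho
    beta_reduce
    rw [this, partitionEntropy_top hp1]
  · have : jointSetoid r (S ∪ T) = jointSetoid r S ⊓ jointSetoid r T := by
      ext w w'
      change (∀ o ∈ S ∪ T, r o w w') ↔ (∀ o ∈ S, r o w w') ∧ ∀ o ∈ T, r o w w'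
      simp only [Finset.mem_union, or_imp, forall_and]
    beta_reduce
    rw [this]
    exact partitionEntropy_submodular hp (jointSetoid_anti r Finset.inter_subset_left)
      (jointSetoid_anti r Finset.inter_subset_right)

/-! ### Entropies of boxes -/

/-- Independent outcomes `a` and `c` have additive entropies. -/
theorem partitionEntropy_of_independent {X Y Z : Type*} [Fintype X] [Fintype Y] [Fintype Z]
    {p : X × Y × Z → ℝ} (hp : ∀ w, 0 ≤ p w)
    (hind : ∀ a c, ∑ b, p (a, b, c) = (∑ b, ∑ c', p (a, b, c')) * ∑ a', ∑ b, p (a', b, c))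
    {r s u : Setoid (X × Y × Z)} (hr : ∀ w w', r w w' ↔ w.1 = w'.1)
    (hs : ∀ w w', s w w' ↔ w.2.2 = w'.2.2) (hu : ∀ w w', u w w' ↔ w.1 = w'.1 ∧ w.2.2 = w'.2.2) :
    partitionEntropy p u = partitionEntropy p r + partitionEntropy p s := by
  classical
  refine partitionEntropy_of_mul hp fun w => ?_
  have h1 : cellWeight p u w = ∑ b, p (w.1, b, w.2.2) := by
    simp only [cellWeight, hu, Fintype.sum_prod_type, ite_and]
    simp
  have h2 : cellWeight p r w = ∑ b, ∑ c, p (w.1, b, c) := by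
    simp only [cellWeight, hr, Fintype.sum_prod_type]
    rw [Finset.sum_eq_single w.1]
    · simp
    · intro a _ ha
      simp [ha.symm]
    · simp
  have h3 : cellWeight p s w = ∑ a, ∑ b, p (a, b, w.2.2) := by
    simp only [cellWeight, hs, Fintype.sum_prod_type]
    simp
  rw [h1, h2, h3, hind]

section Boxes

variable {α : Fin 2 → Type*} {β : Type*} {γ : Fin 2 → Type*}

/-- The partition of the outcomes for the settings `x, z` by the value of an observable. -/
def contextSetoid (α : Fin 2 → Type*) (β : Type*) (γ : Fin 2 → Type*) (x z : Fin 2) (o : Obs) :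
    Setoid (α x × β × γ z) where
  r w w' := (o = .A x → w.1 = w'.1) ∧ (o = .B → w.2.1 = w'.2.1) ∧ (o = .C z → w.2.2 = w'.2.2)
  iseqv := ⟨fun w => by simp, fun h => ⟨fun e => (h.1 e).symm, fun e => (h.2.1 e).symm,
    fun e => (h.2.2 e).symm⟩, fun h h' => ⟨fun e => (h.1 e).trans (h'.1 e),
    fun e => (h.2.1 e).trans (h'.2.1 e), fun e => (h.2.2 e).trans (h'.2.2 e)⟩⟩

theorem jointSetoid_contextSetoid (x z : Fin 2) (S : Finset Obs) (w w' : α x × β × γ z) :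
    jointSetoid (contextSetoid α β γ x z) S w w' ↔ (Obs.A x ∈ S → w.1 = w'.1) ∧
      (Obs.B ∈ S → w.2.1 = w'.2.1) ∧ (Obs.C z ∈ S → w.2.2 = w'.2.2) :=
  ⟨fun h => ⟨fun ho => (h _ ho).1 rfl, fun ho => (h _ ho).2.1 rfl, fun ho => (h _ ho).2.2 rfl⟩,
    fun h _ ho => ⟨fun e => h.1 (e ▸ ho), fun e => h.2.1 (e ▸ ho), fun e => h.2.2 (e ▸ ho)⟩⟩

variable [∀ x, Fintype (α x)] [Fintype β] [∀ z, Fintype (γ z)]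

theorem entropyIn_eq (P : Box α β γ) (x z : Fin 2) (S : Finset Obs) :
    entropyIn P x z S = partitionEntropy (fun w => P x z w.1 w.2.1 w.2.2)
      (jointSetoid (contextSetoid α β γ x z) S) := by
  have h := shannonEntropy_pushWeight (restrictOutcome (α := α) (β := β) (γ := γ) S x z)
    (fun w => P x z w.1 w.2.1 w.2.2)
  have hker : Setoid.ker (restrictOutcome (α := α) (β := β) (γ := γ) S x z)
      = jointSetoid (contextSetoid α β γ x z) S := by
    ext w w'
    rw [jointSetoid_contextSetoid, Setoid.ker_def]
    simp only [restrictOutcome, Prod.mk.injEq]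
    refine and_congr ?_ (and_congr ?_ ?_) <;> split_ifs with h <;> simp [h]
  rw [← hker, ← h]
  unfold entropyIn pushWeight
  congr! 5

/-- In a fixed context, the entropies satisfy the Shannon inequalities. -/
theorem isShannon_entropyIn {P : Box α β γ} {x z : Fin 2}
    (hP : IsProb fun w : α x × β × γ z => P x z w.1 w.2.1 w.2.2) :
    IsShannon (entropyIn P x z) := by
  rw [funext (entropyIn_eq P x z)]
  exact isShannon_partitionEntropy hP.1 ((hasSum_fintype _).unique hP.2) _

theorem entropyIn_AC {P : Box α β γ} {x z : Fin 2}
    (hP : IsProb fun w : α x × β × γ z => P x z w.1 w.2.1 w.2.2) (hI : HasIndependentAC P) :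
    entropyIn P x z {.A x, .C z} = entropyIn P x z {.A x} + entropyIn P x z {.C z} := by
  simp only [entropyIn_eq]
  refine partitionEntropy_of_independent hP.1 (hI x z) ?_ ?_ ?_ <;> intro w w' <;>
    rw [jointSetoid_contextSetoid] <;> simp

/-! ### Entropy vectors of no-signaling boxes -/

/-- The partition of the outcomes of two parties by the value of an observable. -/
def pairSetoid (X Y : Type*) (o₁ o₂ : Obs) (o : Obs) : Setoid (X × Y) where
  r w w' := (o = o₁ → w.1 = w'.1) ∧ (o = o₂ → w.2 = w'.2)
  iseqv := ⟨fun w => by simp, fun h => ⟨fun e => (h.1 e).symm, fun e => (h.2 e).symm⟩,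
    fun h h' => ⟨fun e => (h.1 e).trans (h'.1 e), fun e => (h.2 e).trans (h'.2 e)⟩⟩

theorem jointSetoid_pairSetoid {X Y : Type*} {o₁ o₂ : Obs} (S : Finset Obs) (w w' : X × Y) :
    jointSetoid (pairSetoid X Y o₁ o₂) S w w' ↔ (o₁ ∈ S → w.1 = w'.1) ∧ (o₂ ∈ S → w.2 = w'.2) :=
  ⟨fun h => ⟨fun ho => (h _ ho).1 rfl, fun ho => (h _ ho).2 rfl⟩,
    fun h _ ho => ⟨fun e => h.1 (e ▸ ho), fun e => h.2 (e ▸ ho)⟩⟩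

/-- Without `A x` the entropy depends only on the marginal of B and C, which no-signaling makes
independent of `x`. -/
theorem entropyIn_of_A_notMem (P : Box α β γ) (x z : Fin 2) {S : Finset Obs} (h : Obs.A x ∉ S) :
    entropyIn P x z S = partitionEntropy (fun y : β × γ z => ∑ a, P x z a y.1 y.2)
      (jointSetoid (pairSetoid β (γ z) .B (.C z)) S) := by
  classical
  have hpush : (fun y : β × γ z => ∑ a, P x z a y.1 y.2)
      = pushWeight (fun w : α x × β × γ z => w.2) fun w => P x z w.1 w.2.1 w.2.2 := by
    funext y
    rw [pushWeight, Fintype.sum_prod_type]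
    refine Finset.sum_congr rfl fun a _ => ?_
    refine Eq.symm ?_
    rw [Finset.sum_eq_single y]
    · exact if_pos rfl
    · exact fun y' _ hy => if_neg hy
    · exact fun h => absurd (Finset.mem_univ _) h
  rw [entropyIn_eq, hpush, partitionEntropy_pushWeight]
  congr 1
  ext w w'
  refine (jointSetoid_contextSetoid x z S w w').trans
    (Iff.trans ?_ (jointSetoid_pairSetoid S _ _).symm)
  simp [h]

theorem entropyIn_of_C_notMem (P : Box α β γ) (x z : Fin 2) {S : Finset Obs} (h : Obs.C z ∉ S) :
    entropyIn P x z S = partitionEntropy (fun y : α x × β => ∑ c, P x z y.1 y.2 c)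
      (jointSetoid (pairSetoid (α x) β (.A x) .B) S) := by
  classical
  have hpush : (fun y : α x × β => ∑ c, P x z y.1 y.2 c)
      = pushWeight (fun w : α x × β × γ z => (w.1, w.2.1)) fun w => P x z w.1 w.2.1 w.2.2 := by
    funext y
    rw [pushWeight, Fintype.sum_prod_type]
    simp only [Fintype.sum_prod_type]
    rw [Finset.sum_eq_single y.1]
    · rw [Finset.sum_eq_single y.2]
      · simp
      · intro b _ hb
        exact Finset.sum_eq_zero fun c _ => if_neg fun h => hb (congrArg Prod.snd h)
      · simp
    · intro a _ ha
      exact Finset.sum_eq_zero fun b _ => Finset.sum_eq_zero fun c _ =>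
        if_neg fun h => ha (congrArg Prod.fst h)
    · simp
  rw [entropyIn_eq, hpush, partitionEntropy_pushWeight]
  congr 1
  ext w w'
  refine (jointSetoid_contextSetoid x z S w w').trans
    (Iff.trans ?_ (jointSetoid_pairSetoid S _ _).symm)
  simp [h]

theorem entropyIn_change_x {P : Box α β γ} (hP : IsNoSignaling P) {x x' z : Fin 2}
    {S : Finset Obs} (hS : S ⊆ {.A x, .B, .C z}) (hS' : S ⊆ {.A x', .B, .C z}) :
    entropyIn P x z S = entropyIn P x' z S := by
  by_cases h : x = x'
  · rw [h]
  · have h1 : Obs.A x ∉ S := fun hm => by simpa [h] using hS' hm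
    have h2 : Obs.A x' ∉ S := fun hm => by simpa [Ne.symm h] using hS hm
    rw [entropyIn_of_A_notMem P x z h1, entropyIn_of_A_notMem P x' z h2]
    congr 1
    funext y
    exact hP.2.2 x x' z y.1 y.2

theorem entropyIn_change_z {P : Box α β γ} (hP : IsNoSignaling P) {x z z' : Fin 2}
    {S : Finset Obs} (hS : S ⊆ {.A x, .B, .C z}) (hS' : S ⊆ {.A x, .B, .C z'}) :
    entropyIn P x z S = entropyIn P x z' S := by
  by_cases h : z = z'
  · rw [h]
  · have h1 : Obs.C z ∉ S := fun hm => by simpa [h] using hS' hm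
    have h2 : Obs.C z' ∉ S := fun hm => by simpa [Ne.symm h] using hS hm
    rw [entropyIn_of_C_notMem P x z h1, entropyIn_of_C_notMem P x z' h2]
    congr 1
    funext y
    exact hP.2.1 x z z' y.1 y.2

theorem exists_context (S : MSet) : ∃ x z, S.1 ⊆ {.A x, .B, .C z} := by
  revert S
  decide +kernel

theorem exists_isEntropyVector {P : Box α β γ} (hP : IsNoSignaling P) :
    ∃ h, IsEntropyVector P h := by
  choose X Z hXZ using exists_context
  refine ⟨fun S => entropyIn P (X S) (Z S) S.1, fun S x z hS => ?_⟩
  -- The two contexts may differ in both settings; the mixed context allows changing them one at a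
  -- time.
  have hmix : S.1 ⊆ {.A x, .B, .C (Z S)} := by
    intro o ho
    have h1 := hS ho
    have h2 := hXZ S ho
    simp only [Finset.mem_insert, Finset.mem_singleton] at h1 h2 ⊢
    cases o <;> simp_all
  exact (entropyIn_change_x hP (hXZ S) hmix).trans (entropyIn_change_z hP hmix hS)

theorem IsEntropyVector.unique {P : Box α β γ} {g h : MSet → ℝ} (hg : IsEntropyVector P g)
    (hh : IsEntropyVector P h) : g = h := by
  funext S
  obtain ⟨x, z, hS⟩ := exists_context S
  rw [hg S x z hS, hh S x z hS]

/-- The first four classes of inequalities hold for all no-signaling boxes with independent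
outcomes of `A` and `C`. -/
theorem lhs_le_zero_of_isNoSignaling {P : Box α β γ} (hP : IsNoSignaling P)
    (hI : HasIndependentAC P) {h : MSet → ℝ} (hh : IsEntropyVector P h) {k : Fin 10}
    (hk : k.val < 4) {c : MSet → ℤ} (hc : c ∈ symmetryClass (row k)) : lhs c h ≤ 0 := by
  obtain ⟨σ, rfl⟩ := hc
  change lhs (relabel σ (row k)) h ≤ 0
  rw [lhs_relabel]
  generalize σ⁻¹ = τ
  -- All sets occurring in rows 0–3 lie in {A₀, B, C₀}, which the symmetry maps to a single context;
  -- the Shannon inequalities hold there.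
  obtain ⟨x, z, hxz⟩ : ∃ x z,
      (({.A 0} : Finset Obs).image τ.1 = {.A x} ∧ ({.C 0} : Finset Obs).image τ.1 = {.C z}) ∨
      (({.A 0} : Finset Obs).image τ.1 = {.C z} ∧ ({.C 0} : Finset Obs).image τ.1 = {.A x}) := by
    obtain ⟨s, x, z, rfl⟩ := exists_eq_standardSymmetry τ
    rw [coe_standardSymmetry]
    revert s x z
    decide +kernel
  have hB : ({.B} : Finset Obs).image τ.1 = {.B} := by
    obtain ⟨s, x, z, rfl⟩ := exists_eq_standardSymmetry τ
    rw [coe_standardSymmetry]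
    rfl
  have hsub : ({.A 0, .B, .C 0} : Finset Obs).image τ.1 ⊆ {.A x, .B, .C z} := by
    have : ({.A 0, .B, .C 0} : Finset Obs) = {.A 0} ∪ {.B} ∪ {.C 0} := by decide
    rw [this, Finset.image_union, Finset.image_union, hB]
    rcases hxz with ⟨h1, h2⟩ | ⟨h1, h2⟩ <;> rw [h1, h2] <;> clear h1 h2 hB <;> revert x z <;>
      decide
  have hs := (isShannon_entropyIn (hP.1 x z)).map τ.1
  have hind : entropyIn P x z (({.A 0, .C 0} : Finset Obs).image τ.1)
      = entropyIn P x z (({.A 0} : Finset Obs).image τ.1)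
        + entropyIn P x z (({.C 0} : Finset Obs).image τ.1) := by
    have : ({.A 0, .C 0} : Finset Obs) = {.A 0} ∪ {.C 0} := by decide
    rw [this, Finset.image_union]
    have hAC := entropyIn_AC (hP.1 x z) hI
    rcases hxz with ⟨h1, h2⟩ | ⟨h1, h2⟩ <;> rw [h1, h2]
    · exact hAC
    · rw [Finset.union_comm, add_comm]
      exact hAC
  set g : Finset Obs → ℝ := fun S => entropyIn P x z (S.image τ.1) with hg
  have hval : ∀ j : Fin 13, (column j).1 ⊆ {.A 0, .B, .C 0} →
      h (MSet.map τ (column j)) = g (column j).1 := fun j hj =>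
    hh _ x z ((Finset.image_subset_image hj).trans hsub)
  have e0 := hval 0 (by decide)
  have e2 := hval 2 (by decide)
  have e3 := hval 3 (by decide)
  have e5 := hval 5 (by decide)
  have e7 := hval 7 (by decide)
  have e9 := hval 9 (by decide)
  have i1 := hs.submod {.A 0} {.B} (U := {.A 0, .B}) (I := ∅) (by decide) (by decide)
  have i2 := hs.mono (S := {.A 0, .B}) (T := {.A 0, .B, .C 0}) (by decide)
  have i3 := hs.mono (S := {.A 0, .C 0}) (T := {.A 0, .B, .C 0}) (by decide)
  have i4 := hs.submod {.A 0, .B} {.B, .C 0} (U := {.A 0, .B, .C 0}) (I := {.B})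
    (by decide) (by decide)
  have i0 := hs.1
  have hlhs : lhs (row k) (fun S => h (MSet.map τ S))
      = ∑ j, (table k j : ℝ) * h (MSet.map τ (column j)) := lhs_ofColumns _ _
  rw [hlhs]
  simp only [Fin.sum_univ_succ, Finset.univ_unique, Fin.default_eq_zero, Finset.sum_singleton,
    Fin.isValue, Fin.succ_zero_eq_one, Fin.reduceSucc]
  rw [e0, e2, e3, e5, e7, e9]
  simp only [column, Matrix.cons_val] at i0 i1 i2 i3 i4 ⊢
  have hk' : k = 0 ∨ k = 1 ∨ k = 2 ∨ k = 3 := by omega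
  rcases hk' with rfl | rfl | rfl | rfl <;> simp [table] <;> linarith

end Boxes

/-! ### Bilocal models -/

section Bilocal

variable {α : Fin 2 → Type*} [∀ x, Fintype (α x)]

theorem sum_prod_fin_two (g : ∀ x, α x → ℝ) :
    ∑ a : ∀ x, α x, ∏ x, g x (a x) = ∏ x, ∑ a, g x a :=
  (Fintype.prod_sum g).symm

theorem IsProb.sum_eq_one {ι : Type*} [Fintype ι] {p : ι → ℝ} (hp : IsProb p) : ∑ i, p i = 1 :=
  (hasSum_fintype _).unique hp.2

theorem IsProb.le_one {ι : Type*} [Fintype ι] {p : ι → ℝ} (hp : IsProb p) (i : ι) : p i ≤ 1 := by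
  rw [← hp.sum_eq_one]
  exact Finset.single_le_sum (fun j _ => hp.1 j) (Finset.mem_univ i)

-- This is the marginal at coordinate `x` of a product distribution: the indicator becomes one more
-- factor of the product, and the other factors sum to 1.
open Classical in
theorem sum_prod_of_apply_eq {g : ∀ x, α x → ℝ} (hg : ∀ x, IsProb (g x)) (x : Fin 2) (a₀ : α x) :
    ∑ a : ∀ x, α x, (if a x = a₀ then ∏ i, g i (a i) else 0) = g x a₀ := by
  have h := Fintype.prod_sum fun i a =>
    (if h : i = x then (if h ▸ a = a₀ then 1 else 0) else 1) * g i a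
  have hl : ∏ i, ∑ a, (if h : i = x then (if h ▸ a = a₀ then 1 else 0) else 1) * g i a
      = g x a₀ := by
    rw [Finset.prod_eq_single x]
    · simp
    · intro i _ hi
      simp [hi, (hg i).sum_eq_one]
    · simp
  rw [← hl, h]
  refine Finset.sum_congr rfl fun a _ => ?_
  have hone : ∏ i, (if h : i = x then (if h ▸ a i = a₀ then (1 : ℝ) else 0) else 1)
      = if a x = a₀ then 1 else 0 := by
    rw [Finset.prod_eq_single x]
    · simp
    · intro i _ hi
      simp [hi]
    · simp
  rw [Finset.prod_mul_distrib, hone, ite_mul, one_mul, zero_mul]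

variable {β : Type*} [Fintype β] {γ : Fin 2 → Type*} [∀ z, Fintype (γ z)]

/-- The partition of the outcomes of all five observables by the value of one of them. -/
def outcomeSetoid (α : Fin 2 → Type*) (β : Type*) (γ : Fin 2 → Type*) :
    Obs → Setoid ((∀ x, α x) × β × (∀ z, γ z))
  | .A x => Setoid.ker fun w => w.1 x
  | .B => Setoid.ker fun w => w.2.1
  | .C z => Setoid.ker fun w => w.2.2 z

set_option maxHeartbeats 1000000 in
/-- A bilocal box is a marginal of a joint distribution of all five observables, in which the
observables of `A` are independent of those of `C`. -/
theorem exists_joint_of_isBilocal {P : Box α β γ} (hP : IsBilocal P) :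
    ∃ q : (∀ x, α x) × β × (∀ z, γ z) → ℝ, (∀ w, 0 ≤ q w) ∧ ∑ w, q w = 1 ∧
      (∀ x z, pushWeight (fun w => (w.1 x, w.2.1, w.2.2 z)) q
        = fun w => P x z w.1 w.2.1 w.2.2) ∧
      ∀ a c, ∑ b, q (a, b, c) = (∑ b, ∑ c', q (a, b, c')) * ∑ a', ∑ b, q (a', b, c) := by
  classical
  obtain ⟨L₁, L₂, ρ₁, ρ₂, pA, pB, pC, hρ₁, hρ₂, hA, hB, hC, hsum⟩ := hP
  -- Given the hidden variables, outcomes for both settings of A and of C are drawn independently.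
  -- Each term is dominated by `ρ₁ l.1 * ρ₂ l.2`, which settles convergence for infinitely many
  -- values.
  let F : (∀ x, α x) × β × (∀ z, γ z) → L₁ × L₂ → ℝ := fun w l =>
    ρ₁ l.1 * ρ₂ l.2 * ((∏ x, pA x l.1 (w.1 x)) * pB l.1 l.2 w.2.1 * ∏ z, pC z l.2 (w.2.2 z))
  have hρ : Summable fun l : L₁ × L₂ => ρ₁ l.1 * ρ₂ l.2 :=
    hρ₁.2.summable.mul_of_nonneg hρ₂.2.summable hρ₁.1 hρ₂.1
  have hAnn : ∀ l (a : ∀ x, α x), 0 ≤ ∏ x, pA x l (a x) := fun l a =>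
    Finset.prod_nonneg fun x _ => (hA x l).1 _
  have hCnn : ∀ l (c : ∀ z, γ z), 0 ≤ ∏ z, pC z l (c z) := fun l c =>
    Finset.prod_nonneg fun z _ => (hC z l).1 _
  have hA1 : ∀ l (a : ∀ x, α x), ∏ x, pA x l (a x) ≤ 1 := fun l a =>
    Finset.prod_le_one (fun x _ => (hA x l).1 _) fun x _ => (hA x l).le_one _
  have hC1 : ∀ l (c : ∀ z, γ z), ∏ z, pC z l (c z) ≤ 1 := fun l c =>
    Finset.prod_le_one (fun z _ => (hC z l).1 _) fun z _ => (hC z l).le_one _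
  have hFnn : ∀ w l, 0 ≤ F w l := fun w l =>
    mul_nonneg (mul_nonneg (hρ₁.1 _) (hρ₂.1 _))
      (mul_nonneg (mul_nonneg (hAnn _ _) ((hB _ _).1 _)) (hCnn _ _))
  have hF : ∀ w, Summable (F w) := fun w => by
    refine Summable.of_nonneg_of_le (hFnn w) (fun l => ?_) hρ
    refine mul_le_of_le_one_right (mul_nonneg (hρ₁.1 _) (hρ₂.1 _)) ?_
    exact mul_le_one₀ (mul_le_one₀ (hA1 _ _) ((hB _ _).1 _) ((hB _ _).le_one _)) (hCnn _ _)
      (hC1 _ _)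
  have hq : ∀ w, HasSum (F w) (∑' l, F w l) := fun w => (hF w).hasSum
  have hpush : ∀ x z, pushWeight (fun w : (∀ x, α x) × β × (∀ z, γ z) => (w.1 x, w.2.1, w.2.2 z))
      (fun w => ∑' l, F w l) = fun w => P x z w.1 w.2.1 w.2.2 := by
    intro x z
    funext y
    obtain ⟨a₀, b₀, c₀⟩ := y
    have h1 : HasSum (fun l => ∑ w, if (w.1 x, w.2.1, w.2.2 z) = (a₀, b₀, c₀) then F w l else 0)
        (∑ w : (∀ x, α x) × β × (∀ z, γ z),
          if (w.1 x, w.2.1, w.2.2 z) = (a₀, b₀, c₀) then ∑' l, F w l else 0) := by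
      refine hasSum_sum fun w _ => ?_
      split_ifs
      · exact hq w
      · exact hasSum_zero
    have h2 : ∀ l, (∑ w, if (w.1 x, w.2.1, w.2.2 z) = (a₀, b₀, c₀) then F w l else 0)
        = ρ₁ l.1 * ρ₂ l.2 * (pA x l.1 a₀ * pB l.1 l.2 b₀ * pC z l.2 c₀) := by
      intro l
      rw [← sum_prod_of_apply_eq (fun x => hA x l.1) x a₀,
        ← sum_prod_of_apply_eq (fun z => hC z l.2) z c₀, Fintype.sum_prod_type, Finset.sum_mul,
        Finset.sum_mul, Finset.mul_sum]
      refine Finset.sum_congr rfl fun a _ => ?_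
      rw [Fintype.sum_prod_type, Finset.sum_eq_single b₀]
      · rw [Finset.mul_sum, Finset.mul_sum]
        refine Finset.sum_congr rfl fun c _ => ?_
        by_cases ha : a x = a₀ <;> by_cases hc : c z = c₀ <;> simp [F, ha, hc]
      · intro b _ hb
        exact Finset.sum_eq_zero fun c _ => if_neg fun h => hb (by simp_all)
      · simp
    rw [funext h2] at h1
    have h3 := h1.unique (hsum x z a₀ b₀ c₀)
    rw [← h3]
    unfold pushWeight
    congr!
  have htot : ∑ w, ∑' l, F w l = 1 := by
    have h1 : HasSum (fun l => ∑ w, F w l) (∑ w, ∑' l, F w l) := hasSum_sum fun w _ => hq w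
    have h2 : ∀ l : L₁ × L₂, ∑ w, F w l = ρ₁ l.1 * ρ₂ l.2 := by
      intro l
      simp only [F, Fintype.sum_prod_type, ← Finset.mul_sum, sum_prod_fin_two,
        (hA _ _).sum_eq_one, (hC _ _).sum_eq_one, (hB _ _).sum_eq_one, Finset.prod_const_one,
        mul_one]
    rw [funext h2] at h1
    have h3 := hρ₁.2.mul hρ₂.2 hρ
    rw [mul_one] at h3
    exact h1.unique h3
  have hsA : ∀ a : ∀ x, α x, Summable fun l => ρ₁ l * ∏ x, pA x l (a x) := fun a =>
    Summable.of_nonneg_of_le (fun l => mul_nonneg (hρ₁.1 _) (hAnn _ _))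
      (fun l => mul_le_of_le_one_right (hρ₁.1 _) (hA1 _ _)) hρ₁.2.summable
  have hsC : ∀ c : ∀ z, γ z, Summable fun l => ρ₂ l * ∏ z, pC z l (c z) := fun c =>
    Summable.of_nonneg_of_le (fun l => mul_nonneg (hρ₂.1 _) (hCnn _ _))
      (fun l => mul_le_of_le_one_right (hρ₂.1 _) (hC1 _ _)) hρ₂.2.summable
  -- Summing over `b` removes the only factor that depends on both hidden variables, so the double
  -- series factors.
  have hAC : ∀ a c, ∑ b, ∑' l, F (a, b, c) l
      = (∑' l, ρ₁ l * ∏ x, pA x l (a x)) * ∑' l, ρ₂ l * ∏ z, pC z l (c z) := by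
    intro a c
    have h1 : HasSum (fun l => ∑ b, F (a, b, c) l) (∑ b, ∑' l, F (a, b, c) l) :=
      hasSum_sum fun b _ => hq _
    have h2 : ∀ l : L₁ × L₂, ∑ b, F (a, b, c) l
        = (ρ₁ l.1 * ∏ x, pA x l.1 (a x)) * (ρ₂ l.2 * ∏ z, pC z l.2 (c z)) := by
      intro l
      simp only [F, ← Finset.mul_sum, ← Finset.sum_mul, (hB _ _).sum_eq_one]
      ring
    rw [funext h2] at h1
    have hnnA : 0 ≤ fun l => ρ₁ l * ∏ x, pA x l (a x) :=
      Pi.le_def.2 fun l => mul_nonneg (hρ₁.1 l) (hAnn l a)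
    have hnnC : 0 ≤ fun l => ρ₂ l * ∏ z, pC z l (c z) :=
      Pi.le_def.2 fun l => mul_nonneg (hρ₂.1 l) (hCnn l c)
    exact h1.unique
      ((hsA a).hasSum.mul (hsC c).hasSum ((hsA a).mul_of_nonneg (hsC c) hnnA hnnC))
  have hA' : ∑ a : ∀ x, α x, ∑' l, ρ₁ l * ∏ x, pA x l (a x) = 1 := by
    have h1 : HasSum (fun l => ∑ a : ∀ x, α x, ρ₁ l * ∏ x, pA x l (a x)) _ :=
      hasSum_sum fun a _ => (hsA a).hasSum
    simp only [← Finset.mul_sum, sum_prod_fin_two, (hA _ _).sum_eq_one, Finset.prod_const_one,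
      mul_one] at h1
    exact h1.unique hρ₁.2
  have hC' : ∑ c : ∀ z, γ z, ∑' l, ρ₂ l * ∏ z, pC z l (c z) = 1 := by
    have h1 : HasSum (fun l => ∑ c : ∀ z, γ z, ρ₂ l * ∏ z, pC z l (c z)) _ :=
      hasSum_sum fun c _ => (hsC c).hasSum
    simp only [← Finset.mul_sum, sum_prod_fin_two, (hC _ _).sum_eq_one, Finset.prod_const_one,
      mul_one] at h1
    exact h1.unique hρ₂.2
  refine ⟨fun w => ∑' l, F w l, fun w => tsum_nonneg (hFnn w), htot, hpush, fun a c => ?_⟩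
  rw [hAC, Finset.sum_comm]
  simp only [hAC, ← Finset.mul_sum, ← Finset.sum_mul, hA', hC', mul_one, one_mul]

/-- The entropies of a bilocal box form a point of the projected cone. -/
theorem exists_isEntropyVector_mem_marginalCone {P : Box α β γ} (hP : IsBilocal P) :
    ∃ h, IsEntropyVector P h ∧ h ∈ marginalCone := by
  obtain ⟨q, hq0, hq1, hpush, hind⟩ := exists_joint_of_isBilocal hP
  refine ⟨fun S => partitionEntropy q (jointSetoid (outcomeSetoid α β γ) S.1), ?_,
    fun S => partitionEntropy q (jointSetoid (outcomeSetoid α β γ) S),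
    ⟨isShannon_partitionEntropy hq0 hq1 _, ?_⟩, rfl⟩
  · intro S x z hS
    rw [entropyIn_eq, ← hpush x z, partitionEntropy_pushWeight]
    refine congrArg (partitionEntropy q) (Setoid.ext fun w w' => ?_)
    refine Iff.trans ?_ (jointSetoid_contextSetoid x z S.1 _ _).symm
    constructor
    · exact fun h => ⟨fun ho => h _ ho, fun ho => h _ ho, fun ho => h _ ho⟩
    · rintro ⟨h1, h2, h3⟩ o ho
      have := hS ho
      simp only [Finset.mem_insert, Finset.mem_singleton] at this
      rcases this with rfl | rfl | rfl
      exacts [h1 ho, h2 ho, h3 ho]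
  · have hA : ∀ w w', jointSetoid (outcomeSetoid α β γ) {.A 0, .A 1} w w' ↔ w.1 = w'.1 := by
      intro w w'
      rw [jointSetoid_rel, funext_iff, Fin.forall_fin_two]
      simp only [Finset.mem_insert, Finset.mem_singleton, forall_eq_or_imp, forall_eq]
      rfl
    have hC : ∀ w w', jointSetoid (outcomeSetoid α β γ) {.C 0, .C 1} w w' ↔ w.2.2 = w'.2.2 := by
      intro w w'
      rw [jointSetoid_rel, funext_iff, Fin.forall_fin_two]
      simp only [Finset.mem_insert, Finset.mem_singleton, forall_eq_or_imp, forall_eq]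
      rfl
    refine sub_eq_zero.2 (partitionEntropy_of_independent hq0 hind hA hC fun w w' => ?_).symm
    rw [← hA, ← hC]
    simp only [jointSetoid_rel, Finset.mem_union, or_imp, forall_and]

end Bilocal

/-! ### Boxes that violate the other inequalities -/

theorem partitionEntropy_eq_of_cellWeight {Ω : Type*} [Fintype Ω] {p : Ω → ℝ} {r : Setoid Ω}
    (hp : ∑ w, p w = 1) {n : ℕ} (h : ∀ w, p w = 0 ∨ cellWeight p r w = (1 / 2) ^ n) :
    partitionEntropy p r = n := by
  have : ∀ w, p w * Real.logb 2 (cellWeight p r w) = p w * -(n : ℝ) := by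
    intro w
    rcases h w with h | h
    · simp [h]
    · rw [h, one_div, inv_pow, Real.logb_inv, Real.logb_pow]
      simp
  rw [partitionEntropy, Finset.sum_congr rfl fun w _ => this w, ← Finset.sum_mul, hp]
  simp

/-- Four distributions of three bits, in units of `1 / 8`: uniform, or uniform with `a + b + c = 0`,
with `b = a`, or with `b = c`. -/
def bitWeight (τ : Fin 4) (w : Bool × Bool × Bool) : ℕ :=
  ![1, if xor w.1 (xor w.2.1 w.2.2) then 0 else 2, if w.2.1 = w.1 then 2 else 0,
    if w.2.1 = w.2.2 then 2 else 0] τ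

/-- The entropies of these distributions, for the marginals selected by `a, b, c`. -/
def bitEntropy (τ : Fin 4) (a b c : Bool) : ℕ :=
  a.toNat + b.toNat + c.toNat - ![0, (a && b && c).toNat, (a && b).toNat, (b && c).toNat] τ

/-- The distributions of the eight boxes, for all settings. -/
def boxType : Fin 8 → Fin 2 → Fin 2 → Fin 4 :=
  ![![![0, 1], ![1, 1]], ![![1, 0], ![1, 1]], ![![1, 1], ![0, 1]], ![![1, 1], ![1, 0]],
    ![![2, 2], ![1, 1]], ![![1, 1], ![2, 2]], ![![3, 1], ![3, 1]], ![![1, 3], ![1, 3]]]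

/-- Eight no-signaling boxes with binary outcomes. -/
noncomputable def bitBox (i : Fin 8) : Box (fun _ => Bool) Bool (fun _ => Bool) :=
  fun x z a b c => (bitWeight (boxType i x z) (a, b, c) : ℝ) / 8

/-- The entropies of `bitBox i`. -/
def bitBoxEntropy (i : Fin 8) (S : MSet) : ℕ :=
  bitEntropy (boxType i (if Obs.A 1 ∈ S.1 then 1 else 0) (if Obs.C 1 ∈ S.1 then 1 else 0))
    (decide (Obs.A 0 ∈ S.1 ∨ Obs.A 1 ∈ S.1)) (decide (Obs.B ∈ S.1))
    (decide (Obs.C 0 ∈ S.1 ∨ Obs.C 1 ∈ S.1))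

theorem isNoSignaling_bitBox (i : Fin 8) : IsNoSignaling (bitBox i) := by
  refine ⟨fun x z => ⟨fun w => by unfold bitBox; positivity, ?_⟩, fun x z z' a b => ?_,
    fun x x' z b c => ?_⟩
  · have key : ∀ τ, ∑ w, bitWeight τ w = 8 := by decide +kernel
    have h := hasSum_fintype fun w : Bool × Bool × Bool => bitBox i x z w.1 w.2.1 w.2.2
    have h1 : ∑ w : Bool × Bool × Bool, bitBox i x z w.1 w.2.1 w.2.2 = 1 := by
      simp only [bitBox]
      rw [← Finset.sum_div, ← Nat.cast_sum, key]
      norm_num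
    rwa [h1] at h
  · have key : ∀ i x z z' a b, ∑ c, bitWeight (boxType i x z) (a, b, c)
        = ∑ c, bitWeight (boxType i x z') (a, b, c) := by decide +kernel
    simp only [bitBox, ← Finset.sum_div, ← Nat.cast_sum]
    rw [key i x z z' a b]
  · have key : ∀ i x x' z b c, ∑ a, bitWeight (boxType i x z) (a, b, c)
        = ∑ a, bitWeight (boxType i x' z) (a, b, c) := by decide +kernel
    simp only [bitBox, ← Finset.sum_div, ← Nat.cast_sum]
    rw [key i x x' z b c]

theorem hasIndependentAC_bitBox (i : Fin 8) : HasIndependentAC (bitBox i) := by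
  intro x z a c
  have key : ∀ τ a c, 8 * ∑ b, bitWeight τ (a, b, c)
      = (∑ b, ∑ c', bitWeight τ (a, b, c')) * ∑ a', ∑ b, bitWeight τ (a', b, c) := by
    decide +kernel
  have h : (8 : ℝ) * ∑ b, (bitWeight (boxType i x z) (a, b, c) : ℝ)
      = (∑ b, ∑ c', (bitWeight (boxType i x z) (a, b, c') : ℝ))
        * ∑ a', ∑ b, (bitWeight (boxType i x z) (a', b, c) : ℝ) := by
    exact_mod_cast key (boxType i x z) a c
  simp only [bitBox, ← Finset.sum_div]
  rw [div_mul_div_comm, ← h]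
  ring

theorem entropyIn_bitBox (i : Fin 8) (x z : Fin 2) (S : Finset Obs) :
    entropyIn (bitBox i) x z S = bitEntropy (boxType i x z) (decide (Obs.A x ∈ S))
      (decide (Obs.B ∈ S)) (decide (Obs.C z ∈ S)) := by
  -- All cells of positive weight have weight 2^(−n) with n the entropy; multiplying by 8 keeps the
  -- check in the natural numbers.
  have key : ∀ τ a b c w, bitWeight τ w = 0 ∨
      (∑ w' : Bool × Bool × Bool, if (a = true → w.1 = w'.1) ∧ (b = true → w.2.1 = w'.2.1) ∧
        (c = true → w.2.2 = w'.2.2) then bitWeight τ w' else 0) * 2 ^ bitEntropy τ a b c = 8 := by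
    decide +kernel
  rw [entropyIn_eq]
  refine partitionEntropy_eq_of_cellWeight
    (IsProb.sum_eq_one ((isNoSignaling_bitBox i).1 x z)) fun w => ?_
  rcases key (boxType i x z) (decide (Obs.A x ∈ S)) (decide (Obs.B ∈ S)) (decide (Obs.C z ∈ S)) w
    with h | h
  · exact .inl (by simp [bitBox, h])
  · refine .inr ?_
    simp only [decide_eq_true_eq] at h
    have hcell : cellWeight (fun w : Bool × Bool × Bool => bitBox i x z w.1 w.2.1 w.2.2)
        (jointSetoid (contextSetoid (fun _ => Bool) Bool (fun _ => Bool) x z) S) w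
        = ((∑ w' : Bool × Bool × Bool, if (Obs.A x ∈ S → w.1 = w'.1) ∧
          (Obs.B ∈ S → w.2.1 = w'.2.1) ∧ (Obs.C z ∈ S → w.2.2 = w'.2.2) then
            bitWeight (boxType i x z) w' else 0 : ℕ) : ℝ) / 8 := by
      classical
      rw [Nat.cast_sum, Finset.sum_div]
      refine Finset.sum_congr rfl fun w' _ => ?_
      have hiff := jointSetoid_contextSetoid (α := fun _ => Bool) (β := Bool) (γ := fun _ => Bool)
        x z S w w'
      by_cases hw : (Obs.A x ∈ S → w.1 = w'.1) ∧ (Obs.B ∈ S → w.2.1 = w'.2.1) ∧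
          (Obs.C z ∈ S → w.2.2 = w'.2.2)
      · rw [if_pos (hiff.2 hw)]
        simp only [if_pos hw]
        rfl
      · rw [if_neg (hiff.not.2 hw)]
        simp only [if_neg hw, Nat.cast_zero, zero_div]
    rw [hcell, one_div, inv_pow, div_eq_iff (by norm_num), eq_comm, inv_mul_eq_iff_eq_mul₀
      (by positivity), mul_comm]
    exact_mod_cast h.symm

theorem isEntropyVector_bitBox (i : Fin 8) :
    IsEntropyVector (bitBox i) fun S => (bitBoxEntropy i S : ℝ) := by
  intro S x z hS
  -- `bitBoxEntropy` takes setting 0 for a party absent from `S`; the check shows that this choice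
  -- is immaterial.
  have key : ∀ i x z, ∀ S : MSet, S.1 ⊆ {.A x, .B, .C z} →
      bitBoxEntropy i S = bitEntropy (boxType i x z) (decide (Obs.A x ∈ S.1))
        (decide (Obs.B ∈ S.1)) (decide (Obs.C z ∈ S.1)) := by
    decide +kernel
  rw [entropyIn_bitBox]
  beta_reduce
  exact_mod_cast key i x z S hS

/-- Boxes 0–3 (a + b + c = 0 for all settings but one pair) serve the classes of rows 6–9; boxes 4–7
(b copies one party's bit for one of its settings) those of rows 4 and 5. -/
theorem exists_bitBox_violates {k : Fin 10} (hk : 4 ≤ k.val) {c : MSet → ℤ}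
    (hc : c ∈ symmetryClass (row k)) :
    ∃ i, 0 < lhs c fun S => (bitBoxEntropy i S : ℝ) := by
  have key : ∀ k : Fin 10, 4 ≤ k.val → ∀ s x z, ∃ i,
      0 < ∑ j, table k (columnMap s x z j) * (bitBoxEntropy i (column j) : ℤ) := by
    decide +kernel
  obtain ⟨s, x, z, rfl⟩ := mem_symmetryClass_row.1 hc
  obtain ⟨i, hi⟩ := key k hk s x z
  refine ⟨i, ?_⟩
  rw [lhs_ofColumns]
  exact_mod_cast hi

theorem mainTheorem4 :
    -- the projected cone is described by 4 equations and the inequalities of the table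
    marginalCone = {h | (∀ x z, mutualInfoAC h x z = 0) ∧
      ∀ c ∈ bilocalityInequalities, lhs c h ≤ 0} ∧
    -- the 4 equations are exactly the linear equations satisfied on the cone
    (Submodule.span ℝ marginalCone : Set (MSet → ℝ)) = {h | ∀ x z, mutualInfoAC h x z = 0} ∧
    -- there are 52 inequalities, and they are tight: they correspond to the facets of the cone
    bilocalityInequalities.ncard = 52 ∧
    Set.BijOn (fun c => {h ∈ marginalCone | lhs c h = 0}) bilocalityInequalities
      {F | IsFacet marginalCone F} ∧
    -- they form 10 symmetry classes, each represented by exactly one row of the table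
    (symmetryClass '' bilocalityInequalities).ncard = 10 ∧
    (∀ c ∈ bilocalityInequalities, ∃! k, c ∈ symmetryClass (row k)) ∧
    -- every bilocal model satisfies them
    (∀ (α : Fin 2 → Type*) (β : Type*) (γ : Fin 2 → Type*)
      [∀ x, Fintype (α x)] [Fintype β] [∀ z, Fintype (γ z)] (P : Box α β γ), IsBilocal P →
      ∃ h, IsEntropyVector P h ∧ h ∈ marginalCone ∧ (∀ x z, mutualInfoAC h x z = 0) ∧
        ∀ c ∈ bilocalityInequalities, lhs c h ≤ 0) ∧
    -- the first four classes hold for all no-signaling boxes with independent `A` and `C`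
    (∀ (α : Fin 2 → Type*) (β : Type*) (γ : Fin 2 → Type*)
      [∀ x, Fintype (α x)] [Fintype β] [∀ z, Fintype (γ z)] (P : Box α β γ),
      IsNoSignaling P → HasIndependentAC P →
      ∃ h, IsEntropyVector P h ∧
        ∀ k : Fin 10, k.val < 4 → ∀ c ∈ symmetryClass (row k), lhs c h ≤ 0) ∧
    -- the other six classes can be violated by such boxes when they are not bilocal
    (∀ k : Fin 10, 4 ≤ k.val → ∀ c ∈ symmetryClass (row k),
      ∃ (P : Box (fun _ => Bool) Bool (fun _ => Bool)) (h : MSet → ℝ),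
        IsNoSignaling P ∧ HasIndependentAC P ∧ ¬ IsBilocal P ∧
        IsEntropyVector P h ∧ 0 < lhs c h) := by
  have hK : marginalCone = {h | (∀ x z, mutualInfoAC h x z = 0) ∧
      ∀ c ∈ bilocalityInequalities, lhs c h ≤ 0} := marginalCone_eq
  refine ⟨hK, ?_, ncard_bilocalityInequalities, span_and_facets_marginalCone.2,
    ncard_symmetryClasses, fun c hc => existsUnique_mem_symmetryClass hc,
    fun α β γ _ _ _ P hP => ?_, fun α β γ _ _ _ P hP hI => ?_, fun k hk c hc => ?_⟩
  · rw [span_and_facets_marginalCone.1]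
    rfl
  · obtain ⟨h, hh, hm⟩ := exists_isEntropyVector_mem_marginalCone hP
    have hm' := hm
    rw [hK] at hm'
    exact ⟨h, hh, hm, hm'⟩
  · obtain ⟨h, hh⟩ := exists_isEntropyVector hP
    exact ⟨h, hh, fun k hk c hc => lhs_le_zero_of_isNoSignaling hP hI hh hk hc⟩
  · obtain ⟨i, hi⟩ := exists_bitBox_violates hk hc
    refine ⟨bitBox i, _, isNoSignaling_bitBox i, hasIndependentAC_bitBox i, fun hb => ?_,
      isEntropyVector_bitBox i, hi⟩
    -- Entropy vectors are unique, so bilocality would put the violating vector into the cone.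
    obtain ⟨h, hh, hm⟩ := exists_isEntropyVector_mem_marginalCone hb
    rw [hh.unique (isEntropyVector_bitBox i), hK] at hm
    exact hi.not_ge (hm.2 c (Set.mem_iUnion.2 ⟨k, hc⟩))
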